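/- Let $n\ge 1$, $d\in(0,n]$, and let $L\ge 1$, $c>0$, $c_1>0$, $C_1\ge 1$, $\gamma>0$, $N\in\mathbb N$, $A\in\mathbb{R}$ and $m>1$ be given. Then there is a constant $C>0$, depending only on these parameters, such that the following holds. Let $\Omega\subset\mathbb R^{n+1}$ be an open set, write $\sigma=\mathcal H^d\lfloor_{\partial\Omega}$, $\delta(X)=\operatorname{dist}(X,\partial\Omega)$ and $\Delta(x,r)=B(x,r)\cap\partial\Omega$, and suppose that for all $x\in\partial\Omega$ and $0<r<\operatorname{diam}(\partial\Omega)$ (a diameter that may be infinite) * ($d$-ADR) $L^{-1}r^d\le\sigma(\Delta(x,r))\le L r^d$, * (corkscrew) there is $X\in\Omega$ with $B(X,cr)\subset B(x,r)\cap\Omega$. Let $\mathbb D=\bigcup_{k\in\mathbb Z}\mathbb D_k$ be a dyadic system on $\partial\Omega$ with constants $c_1,C_1,\gamma,N$. That is, each $\mathbb D_k$ is a countable partition of $\partial\Omega$ into Borel sets (cubes); any two cubes $Q,P\in\mathbb D$ satisfy $Q\cap P\in\{\emptyset,Q,P\}$; for every $Q\in\mathbb D_k$ there is $z\in\partial\Omega$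 with $\Delta(z,c_12^{-k})\subset Q\subset\Delta(z,C_12^{-k})$; every $Q\in\mathbb D_k$ is the union of at most $N$ cubes of $\mathbb D_{k+1}$; and $\sigma(\{x\in Q:\operatorname{dist}(x,\partial\Omega\setminus Q)\le\varrho 2^{-k}\})\le C_1\varrho^\gamma\sigma(Q)$ for all $Q\in\mathbb D_k$ and $0<\varrho<c_1$ (with $\operatorname{dist}(x,\emptyset)=\infty$). Let $Q_0\in\mathbb D$, let $\{Q_j\}_j\subset\mathbb D$ be a family of cubes with $Q_j\subset Q_0$, let $\alpha_j\in\mathbb R$, and let $f$ be a real function on $\partial\Omega$ with $f=\sum_j\alpha_j1_{Q_j}$ $\sigma$-a.e. Suppose that * $f\in\mathrm{BMO}(\partial\Omega)$, i.e. $f$ is locally $\sigma$-integrable and $\|f\|_{\mathrm{BMO}}=\sup_{x\in\partial\Omega,\,r>0}\frac1{\sigma(\Delta(x,r))}\int_{\Delta(x,r)}|f-\langle f\rangle_{\Delta(x,r)}|\,d\sigma<\infty$, where $\langle f\rangle_{\Delta}$ is the $\sigma$-average of $f$ over $\Delta$, * there is $C_0\ge1$ such that $\sum_{j:\,Q_j\subset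 Q}\sigma(Q_j)\le C_0\,\sigma(Q)$ for every $Q\in\mathbb D$, * $|\alpha_j|\le A\|f\|_{\mathrm{BMO}}$ for every $j$. Then there is a real function $F$ on $\Omega$ such that 1. $F\in C^\infty(\Omega)$ and $|\nabla F(X)|\le C\|f\|_{\mathrm{BMO}}\,\delta(X)^{-1}$ for all $X\in\Omega$, 2. for $\sigma$-a.e. $x\in\partial\Omega$, $F(Y)\to f(x)$ as $Y\to x$ within the cone $\{Z\in\Omega:|Z-x|<m\,\delta(Z)\}$, 3. for all $x\in\partial\Omega$ and $r>0$, $\displaystyle\frac1{r^n}\int_{B(x,r)\cap\Omega}|\nabla F(Y)|\,dY\le C\,C_0\|f\|_{\mathrm{BMO}}$. -/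

import Mathlib

open MeasureTheory Metric Set Filter Topology
open scoped ContDiff

noncomputable section

/-- The space `ℝ^(n+1)` with the Euclidean norm. -/
abbrev Ambient (n : ℕ) : Type := EuclideanSpace ℝ (Fin (n + 1))

/-- The surface measure `σ = H^d ⌊ ∂Ω`, as a measure on the ambient space. -/
def surfaceMeasure {n : ℕ} (d : ℝ) (Ω : Set (Ambient n)) : Measure (Ambient n) :=
  (μH[d]).restrict (frontier Ω)

/-- The distance to the boundary, `δ(X) = dist(X, ∂Ω)`. -/
def bdryDist {n : ℕ} (Ω : Set (Ambient n)) (X : Ambient n) : ℝ :=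
  infDist X (frontier Ω)

/-- The surface ball `Δ(x, r) = B(x, r) ∩ ∂Ω`. -/
def surfaceBall {n : ℕ} (Ω : Set (Ambient n)) (x : Ambient n) (r : ℝ) : Set (Ambient n) :=
  ball x r ∩ frontier Ω

/-- `∂Ω` is `d`-Ahlfors-David regular with constant `L`. The diameter may be infinite. -/
def IsADRBoundary {n : ℕ} (d L : ℝ) (Ω : Set (Ambient n)) : Prop :=
  ∀ x ∈ frontier Ω, ∀ r : ℝ, 0 < r → ENNReal.ofReal r < ediam (frontier Ω) →
    ENNReal.ofReal (L⁻¹ * r ^ d) ≤ surfaceMeasure d Ω (surfaceBall Ω x r) ∧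
      surfaceMeasure d Ω (surfaceBall Ω x r) ≤ ENNReal.ofReal (L * r ^ d)

/-- The corkscrew condition with constant `c`. -/
def IsCorkscrew {n : ℕ} (c : ℝ) (Ω : Set (Ambient n)) : Prop :=
  ∀ x ∈ frontier Ω, ∀ r : ℝ, 0 < r → ENNReal.ofReal r < ediam (frontier Ω) →
    ∃ X ∈ Ω, ball X (c * r) ⊆ ball x r ∩ Ω

/-- A dyadic system on `∂Ω`: `𝔻 k` is the collection of the cubes of generation `k`,
and `c₁, C₁, γ, N` are the structural constants. -/
structure IsDyadicSystem {n : ℕ} (d : ℝ) (Ω : Set (Ambient n)) (c₁ C₁ γ : ℝ) (N : ℕ)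
    (𝔻 : ℤ → Set (Set (Ambient n))) : Prop where
  countable : ∀ k, (𝔻 k).Countable
  borel : ∀ k, ∀ Q ∈ 𝔻 k, MeasurableSet Q
  nested : ∀ k l, ∀ Q ∈ 𝔻 k, ∀ P ∈ 𝔻 l, Q ∩ P = ∅ ∨ Q ∩ P = Q ∨ Q ∩ P = P
  cover : ∀ k, ⋃₀ (𝔻 k) = frontier Ω
  disjoint : ∀ k, (𝔻 k).PairwiseDisjoint id
  /-- Every cube contains, and is contained in, a surface ball of radius comparable to its
  side length `2 ^ (-k)`, with a common center. -/
  balls : ∀ k, ∀ Q ∈ 𝔻 k, ∃ z ∈ frontier Ω,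
    surfaceBall Ω z (c₁ * 2 ^ (-k)) ⊆ Q ∧ Q ⊆ surfaceBall Ω z (C₁ * 2 ^ (-k))
  /-- Every cube is the union of at most `N` cubes of the next generation. -/
  children : ∀ k, ∀ Q ∈ 𝔻 k, ∃ s : Finset (Set (Ambient n)),
    (s : Set (Set (Ambient n))) ⊆ 𝔻 (k + 1) ∧ s.card ≤ N ∧ Q = ⋃₀ (s : Set (Set (Ambient n)))
  /-- Thin boundaries. The extended distance to the empty set is `∞`, so that a cube which is
  all of `∂Ω` has no boundary layer. -/
  thin : ∀ k, ∀ Q ∈ 𝔻 k, ∀ ρ : ℝ, 0 < ρ → ρ < c₁ →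
    surfaceMeasure d Ω
        {x ∈ Q | infEDist x (frontier Ω \ Q) ≤ ENNReal.ofReal (ρ * 2 ^ (-k))} ≤
      ENNReal.ofReal (C₁ * ρ ^ γ) * surfaceMeasure d Ω Q

/-- The (extended) BMO norm of `f` on `∂Ω`: the supremum of the mean oscillations of `f`
over all surface balls. -/
def bmoENorm {n : ℕ} (d : ℝ) (Ω : Set (Ambient n)) (f : Ambient n → ℝ) : ENNReal :=
  ⨆ (x ∈ frontier Ω) (r : ℝ) (_ : 0 < r),
    ⨍⁻ y in surfaceBall Ω x r,
      ‖f y - ⨍ z in surfaceBall Ω x r, f z ∂(surfaceMeasure d Ω)‖ₑ ∂(surfaceMeasure d Ω)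

/-- `f ∈ BMO(∂Ω)`. Only the values of `f` on `∂Ω` matter. -/
def MemBMO {n : ℕ} (d : ℝ) (Ω : Set (Ambient n)) (f : Ambient n → ℝ) : Prop :=
  LocallyIntegrable f (surfaceMeasure d Ω) ∧ bmoENorm d Ω f < ⊤

/-- The BMO norm as a real number; meaningful for `f ∈ BMO(∂Ω)`. -/
def bmoNorm {n : ℕ} (d : ℝ) (Ω : Set (Ambient n)) (f : Ambient n → ℝ) : ℝ :=
  (bmoENorm d Ω f).toReal

/-- The cone of aperture `m` at a boundary point `x`. -/
def ntCone {n : ℕ} (Ω : Set (Ambient n)) (m : ℝ) (x : Ambient n) : Set (Ambient n) :=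
  {Z ∈ Ω | dist Z x < m * bdryDist Ω Z}

end

/-! Write `H` for the BMO norm. The extension is a smoothing, at scale `δ`, of `Y ↦ a (k Y) (p Y)`,
where `2 ^ (-k Y)` is comparable to `δ Y`, `p Y` is a nearest boundary point, and `a k` is a
function on the boundary that is constant on the cubes of generation `k`. Smoothing
(`exists_smoothing`) bounds the gradient by the local oscillation divided by `δ`, and preserves
local constants. So `a` needs three properties: neighbouring values differ by at most a multiple of
`H`, with no `C₀`; the sets where `a` changes from one generation to the next are packed with
constant of order `C₀`; and almost everywhere `a k` eventually equals `f`.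

Two natural candidates fail. The partial sums `s` of the series have the last two properties, but
their oscillation may depend on `C₀`. The cube averages `φ` of `f` oscillate by at most a multiple
of `H`, but may change in every generation. The remedy (`exists_approximating_process`) is to keep
an old average until the current one has moved by more than `τ`, of order `H`. This stopped process
`b` stays within `τ` of `φ`, and its changes are packed with an absolute constant, since each lowers
the `L¹` distance to `f` by at least `τ / 2` times the measure of the cube. Then `a` is `s` clamped
to `[b - 2τ, b + 2τ]`: it is close to `φ`, changes only where `b` or `s` does, and agrees with `f`
in the limit because the clamp becomes inactive.

If the extension is not constant near `X`, then a boundary point near `X` is close to the boundary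
of a cube where `a` changes, or of a cube of the initial generation
(`IsAdapted.exists_mem_jumpSet`). Thin boundaries make such layers decay geometrically, so these
jump sets inherit the packing (`IsDyadicSystem.tsum_measure_jumpSet_le`). Summing the volumes of
their neighbourhoods gives the Carleson estimate (`IsDyadicSystem.lintegral_gradient_le`). By
Borel–Cantelli almost every `x` is eventually far from the jump sets, so `F` equals `f x` in the
cone near `x` (`IsDyadicSystem.tendsto_ntCone`). -/

/-! ### Smoothing at the scale of the distance to the boundary -/

/-- A `ρ`-separated finite subset of a ball of radius `R` has at most `((R + ρ / 2) / (ρ / 2)) ^ D`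
points. -/
lemma card_mul_pow_le_of_separated {n : ℕ} (s : Finset (Ambient n)) (x : Ambient n) {R ρ : ℝ}
    (hR : 0 ≤ R) (hρ : 0 < ρ) (hs : ∀ y ∈ s, dist y x ≤ R)
    (hsep : ∀ y ∈ s, ∀ z ∈ s, y ≠ z → ρ ≤ dist y z) :
    (s.card : ℝ) * (ρ / 2) ^ (n + 1) ≤ (R + ρ / 2) ^ (n + 1) := by
  have hfin : Module.finrank ℝ (Ambient n) = n + 1 := by simp
  have hdisj : (s : Set (Ambient n)).PairwiseDisjoint (fun y => ball y (ρ / 2)) := by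
    intro y hy z hz hyz
    exact ball_disjoint_ball (by linarith [hsep y hy z hz hyz])
  have hsub : (⋃ y ∈ s, ball y (ρ / 2)) ⊆ ball x (R + ρ / 2) := by
    refine iUnion₂_subset fun y hy => ball_subset_ball' ?_
    linarith [hs y hy]
  have h1 := measure_mono (μ := volume) hsub
  rw [measure_biUnion_finset hdisj fun _ _ => measurableSet_ball] at h1
  have h0 : volume (ball (0 : Ambient n) 1) ≠ 0 := (measure_ball_pos _ _ one_pos).ne'
  have hT : volume (ball (0 : Ambient n) 1) ≠ ⊤ := measure_ball_lt_top.ne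
  rw [Finset.sum_congr rfl fun y _ => Measure.addHaar_ball volume y (by positivity : 0 ≤ ρ / 2),
    Measure.addHaar_ball volume x (by positivity), hfin, Finset.sum_const, nsmul_eq_mul,
    ← mul_assoc] at h1
  rw [ENNReal.mul_le_mul_iff_left h0 hT] at h1
  have h2 : ENNReal.ofReal ((s.card : ℝ) * (ρ / 2) ^ (n + 1))
      ≤ ENNReal.ofReal ((R + ρ / 2) ^ (n + 1)) := by
    rwa [ENNReal.ofReal_mul (by positivity), ENNReal.ofReal_natCast]
  exact (ENNReal.ofReal_le_ofReal_iff (by positivity)).1 h2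

/-- Maximal sets of points separated at the scale of `δ`. -/
lemma exists_maximal_separated {n : ℕ} (Ω : Set (Ambient n)) (δ : Ambient n → ℝ) {ε : ℝ}
    (hε : 0 < ε) (hpos : ∀ X ∈ Ω, 0 < δ X) :
    ∃ T ⊆ Ω, (∀ x ∈ T, ∀ y ∈ T, x ≠ y → ε * δ x ≤ dist x y) ∧
      ∀ X ∈ Ω, ∃ y ∈ T, dist X y < ε * δ X ∨ dist X y < ε * δ y := by
  obtain ⟨T, hT⟩ := zorn_subset
    {T : Set (Ambient n) | T ⊆ Ω ∧ ∀ x ∈ T, ∀ y ∈ T, x ≠ y → ε * δ x ≤ dist x y} (by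
      intro 𝒞 h𝒞 hchain
      refine ⟨⋃₀ 𝒞, ⟨sUnion_subset fun T hT => (h𝒞 hT).1, ?_⟩, fun T hT => subset_sUnion_of_mem hT⟩
      rintro x ⟨T₁, hT₁, hx⟩ y ⟨T₂, hT₂, hy⟩ hxy
      rcases hchain.total hT₁ hT₂ with h | h
      · exact (h𝒞 hT₂).2 x (h hx) y hy hxy
      · exact (h𝒞 hT₁).2 x hx y (h hy) hxy)
  refine ⟨T, hT.prop.1, hT.prop.2, fun X hX => ?_⟩
  by_contra! hcon
  have hXT : X ∉ T := fun h => by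
    have := (hcon X h).1
    rw [dist_self] at this
    nlinarith [hpos X hX]
  have hins : insert X T ∈
      {T : Set (Ambient n) | T ⊆ Ω ∧ ∀ x ∈ T, ∀ y ∈ T, x ≠ y → ε * δ x ≤ dist x y} := by
    refine ⟨insert_subset hX hT.prop.1, ?_⟩
    rintro x (rfl | hx) y (rfl | hy) hxy
    · exact absurd rfl hxy
    · exact (hcon y hy).1
    · rw [dist_comm]; exact (hcon x hx).2
    · exact hT.prop.2 x hx y hy hxy
  exact hXT (hT.le_of_ge hins (subset_insert X T) (mem_insert X T))

/-- Smoothing at the scale of `δ`: any function `G` on `Ω` is approximated by a smooth function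
whose value and gradient at `X` are controlled by the oscillation of `G` near `X`. -/
lemma exists_smoothing (n : ℕ) : ∃ C : ℝ, 0 < C ∧
    ∀ (Ω : Set (Ambient n)) (δ : Ambient n → ℝ), IsOpen Ω → LipschitzWith 1 δ →
      (∀ X ∈ Ω, 0 < δ X) → ∀ G : Ambient n → ℝ, ∃ F : Ambient n → ℝ, ContDiffOn ℝ ∞ F Ω ∧
        ∀ X ∈ Ω, ∀ B g : ℝ, (∀ Y ∈ Ω, dist Y X ≤ δ X / 10 → |G Y - g| ≤ B) →
          |F X - g| ≤ B ∧ ‖gradient F X‖ ≤ C * B / δ X := by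
  let χ : ContDiffBump (0 : Ambient n) := ⟨1, 2, one_pos, one_lt_two⟩
  have hχs : ContDiff ℝ ∞ χ := χ.contDiff
  obtain ⟨L, hL⟩ : ∃ L, ∀ x, ‖fderiv ℝ χ x‖ ≤ L :=
    (hχs.continuous_fderiv (by simp)).bounded_above_of_compact_support
      (χ.hasCompactSupport.fderiv ℝ)
  have hL0 : 0 ≤ L := (norm_nonneg _).trans (hL 0)
  refine ⟨2 * 100 ^ (n + 1) * (L * 100) + 1, by positivity, ?_⟩
  intro Ω δ hΩ hδ hpos G
  have hlip : ∀ X Y, |δ X - δ Y| ≤ dist X Y := fun X Y => by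
    have := hδ.dist_le_mul X Y
    rwa [Real.dist_eq, NNReal.coe_one, one_mul] at this
  obtain ⟨T, hTΩ, hsep, hcov⟩ := exists_maximal_separated Ω δ (ε := 1 / 100) (by norm_num) hpos
  -- The scale 50 makes `ψ y` equal to 1 within `δ y / 50` of `y`, which absorbs both alternatives
  -- of the covering at `ε = 1 / 100`, and zero beyond `δ y / 25`, well inside the window `δ X /
  -- 10`.
  let ψ : Ambient n → Ambient n → ℝ := fun y X => χ ((50 / δ y) • (X - y))
  have hψs : ∀ y, ContDiff ℝ ∞ (ψ y) := fun y =>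
    hχs.comp ((contDiff_id.sub contDiff_const).const_smul (50 / δ y))
  have hψ0 : ∀ y X, 0 ≤ ψ y X := fun y X => χ.nonneg
  have hnorm : ∀ y ∈ T, ∀ X, ‖(50 / δ y) • (X - y)‖ = 50 / δ y * dist X y := fun y hy X => by
    rw [norm_smul, Real.norm_of_nonneg (by have := hpos y (hTΩ hy); positivity), dist_eq_norm]
  have hψ1 : ∀ y ∈ T, ∀ X, dist X y ≤ δ y / 50 → ψ y X = 1 := fun y hy X h => by
    have hy0 := hpos y (hTΩ hy)
    refine χ.one_of_mem_closedBall ?_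
    rw [mem_closedBall, dist_zero_right, hnorm y hy]
    change _ ≤ (1 : ℝ)
    rw [div_mul_eq_mul_div, div_le_one hy0]
    linarith
  have hψsupp : ∀ y ∈ T, ∀ X, ψ y X ≠ 0 → dist X y < δ y / 25 := fun y hy X h => by
    have hy0 := hpos y (hTΩ hy)
    by_contra! hcon
    refine h (χ.zero_of_le_dist ?_)
    rw [dist_zero_right, hnorm y hy]
    change (2 : ℝ) ≤ _
    rw [div_mul_eq_mul_div, le_div_iff₀ hy0]
    linarith
  have hψd : ∀ y ∈ T, ∀ X, ‖fderiv ℝ (ψ y) X‖ ≤ L * (50 / δ y) := fun y hy X => by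
    have hy0 := hpos y (hTΩ hy)
    have h1 : HasFDerivAt (fun X : Ambient n => (50 / δ y) • (X - y))
        ((50 / δ y) • ContinuousLinearMap.id ℝ (Ambient n)) X :=
      ((hasFDerivAt_id X).sub_const y).fun_const_smul _
    have h2 := (((hχs.differentiable (by simp)) ((50 / δ y) • (X - y))).hasFDerivAt.comp X h1).fderiv
    change fderiv ℝ (ψ y) X = _ at h2
    rw [h2]
    refine (ContinuousLinearMap.opNorm_comp_le _ _).trans ?_
    refine mul_le_mul (hL _) ?_ (norm_nonneg _) hL0
    rw [norm_smul, Real.norm_of_nonneg (by positivity)]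
    exact mul_le_of_le_one_right (by positivity) ContinuousLinearMap.norm_id_le
  let F : Ambient n → ℝ := fun X => (∑' y : T, ψ y X * G y) / ∑' y : T, ψ y X
  -- a finite set of active indices near each point
  have hact : ∀ X₀ ∈ Ω, ∃ A : Finset (Ambient n), (∀ y ∈ A, y ∈ T ∧ dist y X₀ ≤ δ X₀ / 10) ∧
      (A.card : ℝ) ≤ 100 ^ (n + 1) ∧
      ∀ X ∈ ball X₀ (δ X₀ / 100) ∩ Ω, F X = (∑ y ∈ A, ψ y X * G y) / (∑ y ∈ A, ψ y X) ∧
        1 ≤ ∑ y ∈ A, ψ y X := by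
    intro X₀ hX₀
    have hd0 := hpos X₀ hX₀
    let A₀ : Set (Ambient n) := {y ∈ T | dist y X₀ ≤ δ X₀ / 10}
    have hcard : ∀ s : Finset (Ambient n), (s : Set (Ambient n)) ⊆ A₀ →
        (s.card : ℝ) ≤ 100 ^ (n + 1) := by
      intro s hs
      -- In this window `δ y ≥ 9 / 10 * δ X₀`, so the separation is at least `9 / 1000 * δ X₀`.
      have h := card_mul_pow_le_of_separated s X₀ (R := δ X₀ / 10) (ρ := 9 / 1000 * δ X₀)
        (by positivity) (by positivity) (fun y hy => (hs hy).2) (by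
          intro y hy z hz hyz
          refine le_trans ?_ (hsep y (hs hy).1 z (hs hz).1 hyz)
          have := (abs_le.1 ((hlip y X₀).trans (hs hy).2)).1
          linarith)
      have h2 : (δ X₀ / 10 + 9 / 1000 * δ X₀ / 2) ^ (n + 1)
          ≤ 100 ^ (n + 1) * (9 / 1000 * δ X₀ / 2) ^ (n + 1) := by
        rw [← mul_pow]
        exact pow_le_pow_left₀ (by positivity) (by linarith) _
      exact le_of_mul_le_mul_right (h.trans h2) (by positivity)
    have hfin : A₀.Finite := by
      by_contra hinf
      obtain ⟨s, hs, hsc⟩ := Set.Infinite.exists_subset_card_eq hinf (100 ^ (n + 1) + 1)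
      have := hcard s hs
      rw [hsc] at this
      push_cast at this
      linarith
    refine ⟨hfin.toFinset, fun y hy => by simpa [A₀] using hy, hcard _ (by simp), ?_⟩
    rintro X ⟨hXb, hX⟩
    have hXb' : dist X X₀ < δ X₀ / 100 := hXb
    have hlX := abs_le.1 ((hlip X X₀).trans hXb'.le)
    have hz : ∀ y : T, (y : Ambient n) ∉ hfin.toFinset → ψ y X = 0 := by
      intro y hy
      by_contra hne
      have h1 := hψsupp y y.2 X hne
      have h2 := abs_le.1 ((hlip X y).trans h1.le)
      apply hy
      rw [Set.Finite.mem_toFinset]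
      refine ⟨y.2, ?_⟩
      have h3 := dist_triangle (y : Ambient n) X X₀
      rw [dist_comm (y : Ambient n) X] at h3
      linarith
    have hsum : ∀ g : Ambient n → ℝ, (∀ y ∈ T, y ∉ hfin.toFinset → g y = 0) →
        ∑' y : T, g y = ∑ y ∈ hfin.toFinset, g y := by
      intro g hg
      rw [tsum_subtype T g, tsum_eq_sum (s := hfin.toFinset)]
      · refine Finset.sum_congr rfl fun y hy => indicator_of_mem ?_ _
        rw [Set.Finite.mem_toFinset] at hy
        exact hy.1
      · intro y hy
        by_cases hyT : y ∈ T
        · rw [indicator_of_mem hyT, hg y hyT hy]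
        · exact indicator_of_notMem hyT _
    constructor
    · simp only [F]
      rw [hsum (fun y => ψ y X * G y) fun y hy h => by simp [hz ⟨y, hy⟩ h],
        hsum (fun y => ψ y X) fun y hy h => hz ⟨y, hy⟩ h]
    · obtain ⟨y, hy, hXy⟩ := hcov X hX
      have hy0 := hpos y (hTΩ hy)
      have hX0 := hpos X hX
      have hXy' : dist X y ≤ δ y / 50 := by
        rcases hXy with h | h
        · have := abs_le.1 ((hlip X y).trans h.le)
          linarith
        · linarith
      have h1 := hψ1 y hy X hXy'
      have hyA : y ∈ hfin.toFinset := by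
        by_contra hcon
        exact one_ne_zero (h1.symm.trans (hz ⟨y, hy⟩ hcon))
      rw [← h1]
      exact Finset.single_le_sum (f := fun y => ψ y X) (fun y _ => hψ0 y X) hyA
  have hnhds : ∀ X₀ ∈ Ω, ball X₀ (δ X₀ / 100) ∩ Ω ∈ 𝓝 X₀ := fun X₀ hX₀ =>
    inter_mem (ball_mem_nhds _ (by have := hpos X₀ hX₀; positivity)) (hΩ.mem_nhds hX₀)
  have hFsm : ∀ X₀ ∈ Ω, ContDiffAt ℝ ∞ F X₀ := by
    intro X₀ hX₀
    obtain ⟨A, hA, -, hAF⟩ := hact X₀ hX₀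
    have hev : F =ᶠ[𝓝 X₀] fun X => (∑ y ∈ A, ψ y X * G y) / (∑ y ∈ A, ψ y X) := by
      filter_upwards [hnhds X₀ hX₀] with X hX using (hAF X hX).1
    refine ContDiffAt.congr_of_eventuallyEq ?_ hev
    refine ContDiffAt.div ?_ ?_ ?_
    · exact ContDiffAt.sum fun y _ => (hψs y).contDiffAt.mul contDiffAt_const
    · exact ContDiffAt.sum fun y _ => (hψs y).contDiffAt
    · have := (hAF X₀ (mem_of_mem_nhds (hnhds X₀ hX₀))).2
      linarith
  refine ⟨F, fun X hX => (hFsm X hX).contDiffWithinAt, ?_⟩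
  intro X hX B g hB
  have hX0 := hpos X hX
  have hB0 : 0 ≤ B := (abs_nonneg _).trans (hB X hX (by rw [dist_self]; positivity))
  obtain ⟨A, hA, hAc, hAF⟩ := hact X hX
  have hGA : ∀ y ∈ A, |G y - g| ≤ B := fun y hy => hB y (hTΩ (hA y hy).1) (hA y hy).2
  -- Differentiating this product identity, rather than the quotient that defines `F`, produces only
  -- the differences `G y - g`.
  have hmul : ∀ Y ∈ ball X (δ X / 100) ∩ Ω,
      (F Y - g) * (∑ y ∈ A, ψ y Y) = ∑ y ∈ A, ψ y Y * (G y - g) := by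
    intro Y hY
    obtain ⟨h1, h2⟩ := hAF Y hY
    rw [h1, sub_mul, div_mul_cancel₀ _ (by linarith), Finset.mul_sum, ← Finset.sum_sub_distrib]
    exact Finset.sum_congr rfl fun y _ => by ring
  have hXm := mem_of_mem_nhds (hnhds X hX)
  have hS1 := (hAF X hXm).2
  have hval : |F X - g| ≤ B := by
    have h1 : |F X - g| * (∑ y ∈ A, ψ y X) ≤ B * (∑ y ∈ A, ψ y X) := by
      calc |F X - g| * (∑ y ∈ A, ψ y X) = |(F X - g) * (∑ y ∈ A, ψ y X)| := by
            rw [abs_mul, abs_of_nonneg (a := ∑ y ∈ A, ψ y X) (by linarith)]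
        _ = |∑ y ∈ A, ψ y X * (G y - g)| := by rw [hmul X hXm]
        _ ≤ ∑ y ∈ A, |ψ y X * (G y - g)| := Finset.abs_sum_le_sum_abs _ _
        _ ≤ ∑ y ∈ A, B * ψ y X := by
            refine Finset.sum_le_sum fun y hy => ?_
            rw [abs_mul, abs_of_nonneg (hψ0 y X), mul_comm]
            exact mul_le_mul_of_nonneg_right (hGA y hy) (hψ0 y X)
        _ = B * (∑ y ∈ A, ψ y X) := by rw [Finset.mul_sum]
    exact le_of_mul_le_mul_right h1 (by linarith)
  refine ⟨hval, ?_⟩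
  have hψdA : ∀ y ∈ A, ‖fderiv ℝ (ψ y) X‖ ≤ L * (100 / δ X) := by
    intro y hy
    have h1 := abs_le.1 ((hlip y X).trans (hA y hy).2)
    refine (hψd y (hA y hy).1 X).trans (mul_le_mul_of_nonneg_left ?_ hL0)
    rw [div_le_div_iff₀ (by linarith) hX0]
    linarith
  have hdψ : ∀ y, HasFDerivAt (ψ y) (fderiv ℝ (ψ y) X) X := fun y =>
    ((hψs y).differentiable (by simp) X).hasFDerivAt
  have hdF : HasFDerivAt F (fderiv ℝ F X) X :=
    ((hFsm X hX).differentiableAt (by simp)).hasFDerivAt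
  have hdS : HasFDerivAt (fun Y => ∑ y ∈ A, ψ y Y) (∑ y ∈ A, fderiv ℝ (ψ y) X) X :=
    HasFDerivAt.fun_sum fun y _ => hdψ y
  have hdN : HasFDerivAt (fun Y => ∑ y ∈ A, ψ y Y * (G y - g))
      (∑ y ∈ A, (G y - g) • fderiv ℝ (ψ y) X) X :=
    HasFDerivAt.fun_sum fun y _ => (hdψ y).mul_const _
  have hdP := (hdF.sub_const g).mul hdS
  have heq : (∑ y ∈ A, (G y - g) • fderiv ℝ (ψ y) X)
      = (F X - g) • (∑ y ∈ A, fderiv ℝ (ψ y) X) + (∑ y ∈ A, ψ y X) • fderiv ℝ F X := by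
    refine hdN.unique (hdP.congr_of_eventuallyEq ?_)
    filter_upwards [hnhds X hX] with Y hY using (hmul Y hY).symm
  have hn1 : ‖∑ y ∈ A, (G y - g) • fderiv ℝ (ψ y) X‖ ≤ A.card * (B * (L * (100 / δ X))) := by
    rw [← nsmul_eq_mul]
    refine norm_sum_le_of_le A (fun y hy => ?_) |>.trans (by rw [Finset.sum_const])
    rw [norm_smul]
    exact mul_le_mul (hGA y hy) (hψdA y hy) (norm_nonneg _) hB0
  have hn2 : ‖∑ y ∈ A, fderiv ℝ (ψ y) X‖ ≤ A.card * (L * (100 / δ X)) := by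
    rw [← nsmul_eq_mul]
    exact norm_sum_le_of_le A (fun y hy => hψdA y hy) |>.trans (by rw [Finset.sum_const])
  have hq0 : 0 ≤ L * (100 / δ X) := by positivity
  have hfd : ‖fderiv ℝ F X‖ ≤ 2 * 100 ^ (n + 1) * (L * 100) * B / δ X := by
    calc ‖fderiv ℝ F X‖ ≤ ‖(∑ y ∈ A, ψ y X) • fderiv ℝ F X‖ := by
          rw [norm_smul, Real.norm_of_nonneg (by linarith)]
          exact le_mul_of_one_le_left (norm_nonneg _) hS1
      _ = ‖(∑ y ∈ A, (G y - g) • fderiv ℝ (ψ y) X)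
            - (F X - g) • (∑ y ∈ A, fderiv ℝ (ψ y) X)‖ := by rw [heq]; congr 1; abel
      _ ≤ A.card * (B * (L * (100 / δ X))) + B * (A.card * (L * (100 / δ X))) := by
          refine (norm_sub_le _ _).trans (add_le_add hn1 ?_)
          rw [norm_smul]
          exact mul_le_mul hval hn2 (norm_nonneg _) hB0
      _ = A.card * (2 * (B * (L * (100 / δ X)))) := by ring
      _ ≤ 100 ^ (n + 1) * (2 * (B * (L * (100 / δ X)))) :=
          mul_le_mul_of_nonneg_right hAc (by positivity)
      _ = 2 * 100 ^ (n + 1) * (L * 100) * B / δ X := by ring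
  have hg : ‖gradient F X‖ = ‖fderiv ℝ F X‖ := LinearIsometryEquiv.norm_map _ _
  rw [hg]
  refine hfd.trans ?_
  gcongr
  linarith

/-! ### Dyadic cubes, adapted processes and jump sets -/

section Dyadic

/-- The cube of generation `k` that contains `x`. -/
def dyadicCube {n : ℕ} (𝔻 : ℤ → Set (Set (Ambient n))) (k : ℤ) (x : Ambient n) :
    Set (Ambient n) :=
  ⋃₀ {Q ∈ 𝔻 k | x ∈ Q}

/-- `a k` is constant on the cubes of generation `k`. -/
def IsAdapted {n : ℕ} {β : Type*} (Ω : Set (Ambient n)) (𝔻 : ℤ → Set (Set (Ambient n)))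
    (a : ℤ → Ambient n → β) : Prop :=
  ∀ k, ∀ x ∈ frontier Ω, ∀ y ∈ dyadicCube 𝔻 k x, a k y = a k x

/-- The boundary points at which `a` changes from generation `k - 1` to generation `k`. -/
def changeSet {n : ℕ} {β : Type*} (Ω : Set (Ambient n)) (a : ℤ → Ambient n → β) (k : ℤ) :
    Set (Ambient n) :=
  {x ∈ frontier Ω | a k x ≠ a (k - 1) x}

/-- The points at distance at most `M 2 ^ (-j)` from the complement of their cube of generation
`k`; everything if `j ≤ k`. -/
def boundaryLayer {n : ℕ} (Ω : Set (Ambient n)) (𝔻 : ℤ → Set (Set (Ambient n))) (M : ℝ)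
    (k j : ℤ) : Set (Ambient n) :=
  {x ∈ frontier Ω | j ≤ k ∨
    infEDist x (frontier Ω \ dyadicCube 𝔻 k x) ≤ ENNReal.ofReal (M * 2 ^ (-j))}

/-- The points that are close, at scale `2 ^ (-j)`, to the boundary of their cube of generation
`m` or to the boundary of one of their cubes of generation in `(m, j]` at which `a` changes. -/
def jumpSet {n : ℕ} {β : Type*} (Ω : Set (Ambient n)) (𝔻 : ℤ → Set (Set (Ambient n)))
    (a : ℤ → Ambient n → β) (M : ℝ) (m j : ℤ) : Set (Ambient n) :=
  {x ∈ frontier Ω | ∃ l, m ≤ l ∧ l ≤ j ∧ (l = m ∨ x ∈ changeSet Ω a l) ∧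
    x ∈ boundaryLayer Ω 𝔻 M l j}

/-- Sets that are unions of cubes of generation `k`. -/
def IsCubeUnion {n : ℕ} (Ω : Set (Ambient n)) (𝔻 : ℤ → Set (Set (Ambient n))) (k : ℤ)
    (U : Set (Ambient n)) : Prop :=
  U ⊆ frontier Ω ∧ ∀ x ∈ U, dyadicCube 𝔻 k x ⊆ U

variable {n : ℕ} {d : ℝ} {Ω : Set (Ambient n)} {c₁ C₁ γ : ℝ} {N : ℕ}
  {𝔻 : ℤ → Set (Set (Ambient n))} {β : Type*} {a : ℤ → Ambient n → β}

/-- Two nearby points at which `a k` differs are close to the boundary of a cube where `a`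
changes. -/
lemma IsAdapted.mem_jumpSet_or (ha : IsAdapted Ω 𝔻 a) {M : ℝ}
    {m k : ℤ} (hmk : m ≤ k) {y z : Ambient n} (hy : y ∈ frontier Ω) (hz : z ∈ frontier Ω)
    (hyz : dist y z ≤ M * 2 ^ (-k)) (hne : a k y ≠ a k z) :
    y ∈ jumpSet Ω 𝔻 a M m k ∨ z ∈ jumpSet Ω 𝔻 a M m k := by
  have hdist : ∀ l, ∀ u ∈ frontier Ω, ∀ v ∈ frontier Ω, dist u v ≤ M * 2 ^ (-k) →
      v ∉ dyadicCube 𝔻 l u → u ∈ boundaryLayer Ω 𝔻 M l k := by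
    intro l u hu v hv huv hvu
    have hmem : v ∈ frontier Ω \ dyadicCube 𝔻 l u := ⟨hv, hvu⟩
    refine ⟨hu, Or.inr ((infEDist_le_edist_of_mem hmem).trans ?_)⟩
    rw [edist_dist]
    exact ENNReal.ofReal_le_ofReal huv
  by_cases hm : z ∈ dyadicCube 𝔻 m y
  swap
  · exact Or.inl ⟨hy, m, le_rfl, hmk, Or.inl rfl, hdist m y hy z hz hyz hm⟩
  -- At the first generation from `m` on that separates `y` from `z`, the previous values agree, so
  -- one of the two points sees a change there.
  have key : ∀ l, m ≤ l → a l y ≠ a l z →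
      ∃ l', m ≤ l' ∧ l' ≤ l ∧ a l' y ≠ a l' z ∧ (l' = m ∨ a (l' - 1) y = a (l' - 1) z) := by
    intro l hl
    induction l, hl using Int.leInduction with
    | base => exact fun hne => ⟨m, le_rfl, le_rfl, hne, Or.inl rfl⟩
    | succ l hl ih =>
      intro hne
      by_cases hl' : a l y = a l z
      · exact ⟨l + 1, by lia, le_rfl, hne, Or.inr (by simpa using hl')⟩
      · obtain ⟨l', h1, h2, h3⟩ := ih hl'
        exact ⟨l', h1, by lia, h3⟩
  obtain ⟨l, hml, hlk, hl, hl'⟩ := key k hmk hne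
  have hl'' : a (l - 1) y = a (l - 1) z := by
    rcases hl' with rfl | hl'
    · exact absurd (ha l y hy z hm).symm hl
    · exact hl'
  have hzy : z ∉ dyadicCube 𝔻 l y := fun hc => hl (ha l y hy z hc).symm
  have hyz' : y ∉ dyadicCube 𝔻 l z := fun hc => hl (ha l z hz y hc)
  by_cases hc : a l y = a (l - 1) y
  · refine Or.inr ⟨hz, l, hml, hlk, Or.inr ⟨hz, ?_⟩,
      hdist l z hz y hy (by rwa [dist_comm]) hyz'⟩
    rw [← hl'', ← hc]
    exact hl.symm
  · exact Or.inl ⟨hy, l, hml, hlk, Or.inr ⟨hy, hc⟩, hdist l y hy z hz hyz hzy⟩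

/-- Nearby values of `a` in three consecutive generations agree away from the jump sets. -/
lemma IsAdapted.exists_mem_jumpSet (ha : IsAdapted Ω 𝔻 a) {M : ℝ}
    {m k l : ℤ} (hmk : m < k) (hl : k - 1 ≤ l) (hl' : l ≤ k + 1) {y z : Ambient n}
    (hy : y ∈ frontier Ω) (hz : z ∈ frontier Ω) (hyz : dist y z ≤ M * 2 ^ (-k))
    (hM : 0 ≤ M) (hne : a l y ≠ a (k - 1) z) :
    ∃ j, k - 1 ≤ j ∧ j ≤ k + 1 ∧ (y ∈ jumpSet Ω 𝔻 a M m j ∨ z ∈ jumpSet Ω 𝔻 a M m j) := by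
  by_cases h0 : a (k - 1) y = a (k - 1) z
  swap
  · refine ⟨k - 1, le_rfl, by lia, ha.mem_jumpSet_or (by lia) hy hz (hyz.trans ?_) h0⟩
    exact mul_le_mul_of_nonneg_left (zpow_le_zpow_right₀ one_le_two (by lia)) hM
  -- At its own scale the boundary layer is everything, so a point where `a` changes at generation
  -- `j` is in the jump set of scale `j`.
  have hch : ∀ j, k ≤ j → a j y ≠ a (j - 1) y → y ∈ jumpSet Ω 𝔻 a M m j := fun j hj hc =>
    ⟨hy, j, by lia, le_rfl, Or.inr ⟨hy, hc⟩, hy, Or.inl le_rfl⟩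
  rw [← h0] at hne
  by_cases h1 : a k y = a (k - 1) y
  · by_cases h2 : a (k + 1) y = a (k + 1 - 1) y
    · rw [add_sub_cancel_right] at h2
      obtain rfl | rfl | rfl : l = k - 1 ∨ l = k ∨ l = k + 1 := by lia
      · exact absurd rfl hne
      · exact absurd h1 hne
      · exact absurd (h2.trans h1) hne
    · exact ⟨k + 1, by lia, le_rfl, Or.inl (hch _ (by lia) h2)⟩
  · exact ⟨k, by lia, by lia, Or.inl (hch _ le_rfl h1)⟩

namespace IsDyadicSystem

lemma subset_frontier (h : IsDyadicSystem d Ω c₁ C₁ γ N 𝔻) {k : ℤ} {Q : Set (Ambient n)}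
    (hQ : Q ∈ 𝔻 k) : Q ⊆ frontier Ω :=
  h.cover k ▸ subset_sUnion_of_mem hQ

lemma dyadicCube_eq (h : IsDyadicSystem d Ω c₁ C₁ γ N 𝔻) {k : ℤ} {Q : Set (Ambient n)}
    (hQ : Q ∈ 𝔻 k) {x : Ambient n} (hx : x ∈ Q) : dyadicCube 𝔻 k x = Q := by
  refine subset_antisymm (sUnion_subset ?_) (subset_sUnion_of_mem ⟨hQ, hx⟩)
  rintro P ⟨hP, hxP⟩
  by_cases hPQ : P = Q
  · rw [hPQ]
  · exact absurd hx (disjoint_left.1 (h.disjoint k hP hQ hPQ) hxP)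

lemma dyadicCube_mem (h : IsDyadicSystem d Ω c₁ C₁ γ N 𝔻) (k : ℤ) {x : Ambient n}
    (hx : x ∈ frontier Ω) : dyadicCube 𝔻 k x ∈ 𝔻 k := by
  rw [← h.cover k] at hx
  obtain ⟨Q, hQ, hxQ⟩ := hx
  rwa [h.dyadicCube_eq hQ hxQ]

lemma mem_dyadicCube (h : IsDyadicSystem d Ω c₁ C₁ γ N 𝔻) (k : ℤ) {x : Ambient n}
    (hx : x ∈ frontier Ω) : x ∈ dyadicCube 𝔻 k x := by
  rw [← h.cover k] at hx
  obtain ⟨Q, hQ, hxQ⟩ := hx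
  rwa [h.dyadicCube_eq hQ hxQ]

lemma dyadicCube_subset_frontier (h : IsDyadicSystem d Ω c₁ C₁ γ N 𝔻) (k : ℤ) (x : Ambient n) :
    dyadicCube 𝔻 k x ⊆ frontier Ω :=
  sUnion_subset fun _ hQ => h.subset_frontier hQ.1

lemma dyadicCube_succ_subset (h : IsDyadicSystem d Ω c₁ C₁ γ N 𝔻) (k : ℤ) {x : Ambient n}
    (hx : x ∈ frontier Ω) : dyadicCube 𝔻 (k + 1) x ⊆ dyadicCube 𝔻 k x := by
  obtain ⟨s, hs, -, hQ⟩ := h.children k _ (h.dyadicCube_mem k hx)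
  obtain ⟨P, hP, hxP⟩ : x ∈ ⋃₀ (s : Set (Set (Ambient n))) := hQ ▸ h.mem_dyadicCube k hx
  rw [h.dyadicCube_eq (hs hP) hxP, hQ]
  exact subset_sUnion_of_mem hP

lemma dyadicCube_anti (h : IsDyadicSystem d Ω c₁ C₁ γ N 𝔻) {k l : ℤ} (hkl : k ≤ l)
    {x : Ambient n} (hx : x ∈ frontier Ω) : dyadicCube 𝔻 l x ⊆ dyadicCube 𝔻 k x := by
  induction l, hkl using Int.leInduction with
  | base => rfl
  | succ l _ ih => exact (h.dyadicCube_succ_subset l hx).trans ih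

lemma dyadicCube_subset (h : IsDyadicSystem d Ω c₁ C₁ γ N 𝔻) {k l : ℤ} (hkl : k ≤ l)
    {Q : Set (Ambient n)} (hQ : Q ∈ 𝔻 k) {x : Ambient n} (hx : x ∈ Q) :
    dyadicCube 𝔻 l x ⊆ Q := by
  have := h.dyadicCube_anti hkl (h.subset_frontier hQ hx)
  rwa [h.dyadicCube_eq hQ hx] at this

lemma dyadicCube_congr (h : IsDyadicSystem d Ω c₁ C₁ γ N 𝔻) {k l : ℤ} (hkl : k ≤ l)
    {x y : Ambient n} (hx : x ∈ frontier Ω) (hy : y ∈ dyadicCube 𝔻 l x) :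
    dyadicCube 𝔻 k y = dyadicCube 𝔻 k x :=
  h.dyadicCube_eq (h.dyadicCube_mem k hx) (h.dyadicCube_anti hkl hx hy)

lemma dist_le_of_mem_dyadicCube (h : IsDyadicSystem d Ω c₁ C₁ γ N 𝔻) {k : ℤ}
    {x y : Ambient n} (hx : x ∈ frontier Ω) (hy : y ∈ dyadicCube 𝔻 k x) :
    dist y x ≤ 2 * C₁ * 2 ^ (-k) := by
  obtain ⟨z, -, -, hz⟩ := h.balls k _ (h.dyadicCube_mem k hx)
  have h1 : dist y z < _ := (hz hy).1
  have h2 : dist x z < _ := (hz (h.mem_dyadicCube k hx)).1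
  linarith [dist_triangle_right y x z]

lemma isCubeUnion_changeSet (h : IsDyadicSystem d Ω c₁ C₁ γ N 𝔻) (ha : IsAdapted Ω 𝔻 a)
    (k : ℤ) : IsCubeUnion Ω 𝔻 k (changeSet Ω a k) := by
  refine ⟨fun x hx => hx.1, fun x hx y hy => ⟨h.dyadicCube_subset_frontier k x hy, ?_⟩⟩
  rw [ha k x hx.1 y hy,
    ha (k - 1) x hx.1 y (h.dyadicCube_anti (by lia) hx.1 hy)]
  exact hx.2

/-- Points of one cube of generation `j` are within `2 * C₁ * 2 ^ (-j)` of each other and share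
their coarser cubes and changes. Widening the layers by `2 * C₁` thus makes room for whole cubes,
which is what allows neighbourhoods to be measured cube by cube. -/
lemma dyadicCube_subset_jumpSet (h : IsDyadicSystem d Ω c₁ C₁ γ N 𝔻) (hC₁ : 0 ≤ C₁)
    (ha : IsAdapted Ω 𝔻 a) {M : ℝ} (hM : 0 ≤ M) {m j : ℤ} {x : Ambient n}
    (hx : x ∈ jumpSet Ω 𝔻 a M m j) :
    dyadicCube 𝔻 j x ⊆ jumpSet Ω 𝔻 a (M + 2 * C₁) m j := by
  obtain ⟨hxΩ, l, hml, hlj, hch, -, hlay⟩ := hx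
  intro y hy
  have hyΩ := h.dyadicCube_subset_frontier j x hy
  have hcy := h.dyadicCube_congr hlj hxΩ hy
  refine ⟨hyΩ, l, hml, hlj, hch.imp_right fun hc => ?_, hyΩ, hlay.imp_right fun hd => ?_⟩
  · exact (h.isCubeUnion_changeSet ha l).2 x hc (h.dyadicCube_anti hlj hxΩ hy)
  · rw [hcy]
    refine (infEDist_le_infEDist_add_edist (y := x)).trans ?_
    rw [add_mul, ENNReal.ofReal_add (by positivity) (by positivity)]
    refine add_le_add hd ?_
    rw [edist_dist]
    exact ENNReal.ofReal_le_ofReal (h.dist_le_of_mem_dyadicCube hxΩ hy)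

end IsDyadicSystem

namespace IsCubeUnion

lemma inter {k : ℤ} {U V : Set (Ambient n)} (hU : IsCubeUnion Ω 𝔻 k U)
    (hV : IsCubeUnion Ω 𝔻 k V) : IsCubeUnion Ω 𝔻 k (U ∩ V) :=
  ⟨inter_subset_left.trans hU.1, fun x hx => subset_inter (hU.2 x hx.1) (hV.2 x hx.2)⟩

lemma mono (h : IsDyadicSystem d Ω c₁ C₁ γ N 𝔻) {k l : ℤ} (hkl : k ≤ l)
    {U : Set (Ambient n)} (hU : IsCubeUnion Ω 𝔻 k U) : IsCubeUnion Ω 𝔻 l U :=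
  ⟨hU.1, fun x hx => (h.dyadicCube_anti hkl (hU.1 hx)).trans (hU.2 x hx)⟩

lemma of_mem (h : IsDyadicSystem d Ω c₁ C₁ γ N 𝔻) {k : ℤ} {Q : Set (Ambient n)}
    (hQ : Q ∈ 𝔻 k) : IsCubeUnion Ω 𝔻 k Q :=
  ⟨h.subset_frontier hQ, fun _ hx => (h.dyadicCube_eq hQ hx).subset⟩

lemma eq_biUnion (h : IsDyadicSystem d Ω c₁ C₁ γ N 𝔻) {k : ℤ} {U : Set (Ambient n)}
    (hU : IsCubeUnion Ω 𝔻 k U) : U = ⋃ Q ∈ {Q ∈ 𝔻 k | Q ⊆ U}, Q := by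
  refine subset_antisymm (fun x hx => ?_) (iUnion₂_subset fun Q hQ => hQ.2)
  exact mem_biUnion (x := dyadicCube 𝔻 k x) ⟨h.dyadicCube_mem k (hU.1 hx), hU.2 x hx⟩
    (h.mem_dyadicCube k (hU.1 hx))

lemma measurableSet (h : IsDyadicSystem d Ω c₁ C₁ γ N 𝔻) {k : ℤ} {U : Set (Ambient n)}
    (hU : IsCubeUnion Ω 𝔻 k U) : MeasurableSet U := by
  rw [hU.eq_biUnion h]
  exact MeasurableSet.biUnion ((h.countable k).mono fun Q hQ => hQ.1) fun Q hQ => h.borel k Q hQ.1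

lemma lintegral_eq_tsum (h : IsDyadicSystem d Ω c₁ C₁ γ N 𝔻) {k : ℤ} {U : Set (Ambient n)}
    (hU : IsCubeUnion Ω 𝔻 k U) (μ : Measure (Ambient n)) (g : Ambient n → ENNReal) :
    ∫⁻ x in U, g x ∂μ = ∑' Q : {Q ∈ 𝔻 k | Q ⊆ U}, ∫⁻ x in (Q : Set (Ambient n)), g x ∂μ := by
  conv_lhs => rw [hU.eq_biUnion h]
  exact lintegral_biUnion ((h.countable k).mono fun Q hQ => hQ.1) (fun Q hQ => h.borel k Q hQ.1)
    ((h.disjoint k).subset fun Q hQ => hQ.1) g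

lemma measure_eq_tsum (h : IsDyadicSystem d Ω c₁ C₁ γ N 𝔻) {k : ℤ} {U : Set (Ambient n)}
    (hU : IsCubeUnion Ω 𝔻 k U) (μ : Measure (Ambient n)) :
    μ U = ∑' Q : {Q ∈ 𝔻 k | Q ⊆ U}, μ (Q : Set (Ambient n)) := by
  simpa using hU.lintegral_eq_tsum h μ 1

/-- A measure estimate on the cubes of generation `k` passes to their unions. -/
lemma measure_inter_le (h : IsDyadicSystem d Ω c₁ C₁ γ N 𝔻) {k : ℤ} {U V : Set (Ambient n)}
    (hU : IsCubeUnion Ω 𝔻 k U) (μ : Measure (Ambient n)) {b : ENNReal}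
    (hb : ∀ Q ∈ 𝔻 k, μ (Q ∩ V) ≤ b * μ Q) : μ (U ∩ V) ≤ b * μ U := by
  have hc : {Q ∈ 𝔻 k | Q ⊆ U}.Countable := (h.countable k).mono fun Q hQ => hQ.1
  rw [hU.measure_eq_tsum h μ, ← ENNReal.tsum_mul_left]
  conv_lhs => rw [hU.eq_biUnion h, iUnion₂_inter]
  exact (measure_biUnion_le μ hc _).trans (ENNReal.tsum_le_tsum fun Q => hb Q Q.2.1)

end IsCubeUnion

end Dyadic

/-! ### Packing of jump sets, and measures of cubes and balls -/

section Measure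

variable {n : ℕ} {d : ℝ} {Ω : Set (Ambient n)} {c₁ C₁ γ : ℝ} {N : ℕ}
  {𝔻 : ℤ → Set (Set (Ambient n))} {β : Type*} {a : ℤ → Ambient n → β}

namespace IsDyadicSystem

/-- The thin boundary condition for layers of arbitrary width. -/
lemma measure_inter_boundaryLayer_le (h : IsDyadicSystem d Ω c₁ C₁ γ N 𝔻) (hc₁ : 0 < c₁)
    (hC₁ : 1 ≤ C₁) (hγ : 0 < γ) {M : ℝ} (hM : 0 < M) (l : ℤ) (i : ℕ) {Q : Set (Ambient n)}
    (hQ : Q ∈ 𝔻 l) :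
    surfaceMeasure d Ω (Q ∩ boundaryLayer Ω 𝔻 M l (l + i)) ≤
      ENNReal.ofReal (1 + C₁ * M ^ γ + (M / c₁) ^ γ) * ENNReal.ofReal ((1 / 2) ^ γ) ^ i *
        surfaceMeasure d Ω Q := by
  have hθ : (0 : ℝ) ≤ (1 / 2) ^ γ := by positivity
  have h1 : 0 ≤ C₁ * M ^ γ := by positivity
  have h2 : 0 ≤ (M / c₁) ^ γ := by positivity
  rw [← ENNReal.ofReal_pow hθ, ← ENNReal.ofReal_mul (by positivity)]
  have hpow : ((1 / 2 : ℝ) ^ γ) ^ i = ((1 / 2 : ℝ) ^ i) ^ γ := Real.rpow_pow_comm (by norm_num) γ i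
  have htriv : ∀ t : ℝ, 1 ≤ t → surfaceMeasure d Ω (Q ∩ boundaryLayer Ω 𝔻 M l (l + i)) ≤
      ENNReal.ofReal t * surfaceMeasure d Ω Q := fun t ht => by
    refine (measure_mono inter_subset_left).trans (le_mul_of_one_le_left zero_le ?_)
    rwa [ENNReal.one_le_ofReal]
  -- The three summands of the constant serve three cases: `1` for `i = 0`, `C₁ * M ^ γ` for widths
  -- that the thin boundary condition covers, and `(M / c₁) ^ γ` for `ρ ≥ c₁`, where the trivial
  -- bound is enough.
  rcases Nat.eq_zero_or_pos i with rfl | hi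
  · exact htriv _ (by rw [pow_zero]; linarith)
  set ρ : ℝ := M * (1 / 2) ^ i with hρ
  have hρ0 : 0 < ρ := by positivity
  have hρ2 : ρ * 2 ^ (-l) = M * 2 ^ (-(l + i : ℤ)) := by
    rw [neg_add, zpow_add₀ two_ne_zero, hρ, zpow_neg _ (i : ℤ), zpow_natCast, one_div, inv_pow]
    ring
  by_cases hρc : ρ < c₁
  · refine (measure_mono ?_).trans ((h.thin l Q hQ ρ hρ0 hρc).trans
      (mul_le_mul_left (ENNReal.ofReal_le_ofReal ?_) _))
    · rintro x ⟨hxQ, -, hx⟩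
      refine ⟨hxQ, ?_⟩
      rw [h.dyadicCube_eq hQ hxQ] at hx
      rw [hρ2]
      exact hx.resolve_left (by lia)
    · rw [hpow, hρ, Real.mul_rpow hM.le (by positivity), ← mul_assoc]
      exact mul_le_mul_of_nonneg_right (by linarith) (by positivity)
  · refine htriv _ ?_
    push Not at hρc
    calc (1 : ℝ) ≤ (ρ / c₁) ^ γ := Real.one_le_rpow ((one_le_div hc₁).2 hρc) hγ.le
      _ = (M / c₁) ^ γ * ((1 / 2 : ℝ) ^ γ) ^ i := by
          rw [hpow, ← Real.mul_rpow (by positivity) (by positivity), hρ]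
          congr 1; ring
      _ ≤ _ := mul_le_mul_of_nonneg_right (by linarith) (by positivity)

/-- The jump sets satisfy a packing condition as soon as the change sets do. -/
lemma tsum_measure_jumpSet_le (h : IsDyadicSystem d Ω c₁ C₁ γ N 𝔻) (hc₁ : 0 < c₁)
    (hC₁ : 1 ≤ C₁) (hγ : 0 < γ) {M : ℝ} (hM : 0 < M) (ha : IsAdapted Ω 𝔻 a) {m : ℤ}
    {D : Set (Ambient n)} (hD : IsCubeUnion Ω 𝔻 m D) :
    ∑' i : ℕ, surfaceMeasure d Ω (D ∩ jumpSet Ω 𝔻 a M m (m + i)) ≤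
      ENNReal.ofReal (1 + C₁ * M ^ γ + (M / c₁) ^ γ) * (1 - ENNReal.ofReal ((1 / 2) ^ γ))⁻¹ *
        (surfaceMeasure d Ω D +
          ∑' p : ℕ, surfaceMeasure d Ω (D ∩ changeSet Ω a (m + p + 1))) := by
  set σ := surfaceMeasure d Ω
  set K := ENNReal.ofReal (1 + C₁ * M ^ γ + (M / c₁) ^ γ)
  set θ := ENNReal.ofReal ((1 / 2) ^ γ)
  -- Generation `m` counts in full, whether or not `a` changes there; this is the source of the term
  -- `σ D`.
  let U : ℕ → Set (Ambient n) := fun p => if p = 0 then D else D ∩ changeSet Ω a (m + p)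
  have hU : ∀ p : ℕ, IsCubeUnion Ω 𝔻 (m + p) (U p) := fun p => by
    by_cases hp : p = 0
    · simp only [U, hp, if_true]
      exact hD.mono h (by simp)
    · simp only [U, hp, if_false]
      exact (hD.mono h (by simp)).inter (h.isCubeUnion_changeSet ha _)
  -- A layer of a cube of generation `m + p` has decayed by `θ ^ (i - p)` at scale `m + i`.
  -- Exchanging the sums leaves one geometric series for each `p`.
  have h1 : ∀ i : ℕ, σ (D ∩ jumpSet Ω 𝔻 a M m (m + i)) ≤
      ∑' p : ℕ, if p ≤ i then K * θ ^ (i - p) * σ (U p) else 0 := by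
    intro i
    have hsub : D ∩ jumpSet Ω 𝔻 a M m (m + i) ⊆
        ⋃ p : ℕ, if p ≤ i then U p ∩ boundaryLayer Ω 𝔻 M (m + p) (m + p + (i - p : ℕ)) else ∅ := by
      rintro x ⟨hxD, hxΩ, l, hml, hlj, hch, hlay⟩
      obtain ⟨p, rfl⟩ : ∃ p : ℕ, l = m + p := ⟨(l - m).toNat, by lia⟩
      have hpi : p ≤ i := by lia
      refine mem_iUnion.2 ⟨p, ?_⟩
      rw [if_pos hpi]
      refine ⟨?_, ?_⟩
      · by_cases hp : p = 0
        · simpa only [U, hp, if_true] using hxD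
        · simp only [U, hp, if_false]
          exact ⟨hxD, hch.resolve_left (by lia)⟩
      · rwa [show m + p + (i - p : ℕ) = m + i by lia]
    refine (measure_mono hsub).trans ((measure_iUnion_le _).trans (ENNReal.tsum_le_tsum fun p => ?_))
    split_ifs with hpi
    · exact (hU p).measure_inter_le h σ fun Q hQ =>
        h.measure_inter_boundaryLayer_le hc₁ hC₁ hγ hM (m + p) (i - p) hQ
    · simp
  have h2 : ∀ p : ℕ, ∑' i : ℕ, (if p ≤ i then K * θ ^ (i - p) * σ (U p) else 0) =
      K * (1 - θ)⁻¹ * σ (U p) := by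
    intro p
    rw [← (add_right_injective p).tsum_eq]
    · simp only [le_add_iff_nonneg_right, zero_le, if_true, add_tsub_cancel_left]
      rw [ENNReal.tsum_mul_right, ENNReal.tsum_mul_left, ENNReal.tsum_geometric]
    · intro i hi
      by_cases hpi : p ≤ i
      · exact ⟨i - p, by simp [hpi]⟩
      · simp [hpi] at hi
  calc _ ≤ ∑' (i : ℕ) (p : ℕ), (if p ≤ i then K * θ ^ (i - p) * σ (U p) else 0) :=
        ENNReal.tsum_le_tsum h1
    _ = ∑' p : ℕ, K * (1 - θ)⁻¹ * σ (U p) := by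
        rw [ENNReal.tsum_comm]
        exact tsum_congr h2
    _ = K * (1 - θ)⁻¹ * ∑' p : ℕ, σ (U p) := ENNReal.tsum_mul_left
    _ = _ := by
        rw [tsum_eq_zero_add' ENNReal.summable]
        congr 2
        refine tsum_congr fun p => ?_
        simp only [U, Nat.add_eq_zero_iff, one_ne_zero, and_false, if_false]
        push_cast
        rw [add_assoc]

/-- The measure of a cube is controlled by that of its descendants. -/
lemma measure_le_pow_mul (h : IsDyadicSystem d Ω c₁ C₁ γ N 𝔻) (μ : Measure (Ambient n))
    {B : ENNReal} (i : ℕ) : ∀ k : ℤ, (∀ P ∈ 𝔻 (k + i), μ P ≤ B) → ∀ Q ∈ 𝔻 k,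
      μ Q ≤ N ^ i * B := by
  induction i with
  | zero => intro k hP Q hQ; simpa using hP Q (by simpa using hQ)
  | succ i ih =>
    intro k hP Q hQ
    obtain ⟨s, hs, hcard, rfl⟩ := h.children k Q hQ
    rw [sUnion_eq_biUnion]
    calc μ (⋃ P ∈ (s : Set (Set (Ambient n))), P) ≤ ∑ P ∈ s, μ P := measure_biUnion_finset_le s _
      _ ≤ ∑ P ∈ s, N ^ i * B := Finset.sum_le_sum fun P hPs =>
          ih (k + 1) (fun P hP' => hP P (by
            rwa [show k + ((i + 1 : ℕ) : ℤ) = k + 1 + i by push_cast; ring])) P (hs hPs)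
      _ ≤ N ^ (i + 1) * B := by
          rw [Finset.sum_const, nsmul_eq_mul, pow_succ', mul_assoc]
          gcongr

end IsDyadicSystem

/-- If the boundary is bounded, then the cubes of some generation comparable to its diameter, and
of all coarser generations, are the whole boundary. -/
lemma IsDyadicSystem.exists_generation_eq_frontier (h : IsDyadicSystem d Ω c₁ C₁ γ N 𝔻)
    (hc₁ : 0 < c₁) (h0 : 0 < ediam (frontier Ω)) (htop : ediam (frontier Ω) ≠ ⊤) :
    ∃ k₁ : ℤ, ediam (frontier Ω) < ENNReal.ofReal (c₁ * 2 ^ (-k₁)) ∧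
      ENNReal.ofReal (c₁ * 2 ^ (-k₁) / 4) < ediam (frontier Ω) ∧
      ∀ k ≤ k₁, ∀ Q ∈ 𝔻 k, Q = frontier Ω := by
  set D := (ediam (frontier Ω)).toReal
  have hD0 : 0 < D := ENNReal.toReal_pos h0.ne' htop
  have hDe : ediam (frontier Ω) = ENNReal.ofReal D := (ENNReal.ofReal_toReal htop).symm
  obtain ⟨j, hj1, hj2⟩ := exists_mem_Ico_zpow (div_pos hD0 hc₁) one_lt_two
  rw [le_div_iff₀ hc₁] at hj1
  rw [div_lt_iff₀ hc₁] at hj2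
  refine ⟨-(j + 1), ?_, ?_, ?_⟩
  · rw [hDe, neg_neg, ENNReal.ofReal_lt_ofReal_iff (by positivity)]
    linarith
  · rw [hDe, neg_neg, ENNReal.ofReal_lt_ofReal_iff hD0, zpow_add_one₀ two_ne_zero]
    nlinarith
  · intro k hk Q hQ
    refine subset_antisymm (h.subset_frontier hQ) fun x hx => ?_
    obtain ⟨z, hz, hz1, -⟩ := h.balls k Q hQ
    refine hz1 ⟨?_, hx⟩
    have h1 := edist_le_ediam_of_mem hx hz
    rw [hDe, edist_dist, ENNReal.ofReal_le_ofReal_iff hD0.le] at h1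
    have h2 : (2 : ℝ) ^ (j + 1) ≤ 2 ^ (-k) := zpow_le_zpow_right₀ one_le_two (by lia)
    have h3 : dist x z < c₁ * 2 ^ (-k) := by nlinarith
    exact h3

/-- In a dyadic system on an ADR boundary, the upper bound extends to all radii. -/
lemma exists_forall_surfaceBall_le {L : ℝ} (hd : 0 < d) (hL : 1 ≤ L) (hc₁ : 0 < c₁)
    (C₁ γ : ℝ) (N : ℕ) (n : ℕ) : ∃ L' : ℝ, 1 ≤ L' ∧ ∀ (Ω : Set (Ambient n))
      (𝔻 : ℤ → Set (Set (Ambient n))), IsADRBoundary d L Ω → 0 < ediam (frontier Ω) →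
      IsDyadicSystem d Ω c₁ C₁ γ N 𝔻 → ∀ x ∈ frontier Ω, ∀ r : ℝ, 0 < r →
        surfaceMeasure d Ω (surfaceBall Ω x r) ≤ ENNReal.ofReal (L' * r ^ d) := by
  obtain ⟨i, hi⟩ := pow_unbounded_of_one_lt (4 * C₁ / c₁) (one_lt_two (α := ℝ))
  refine ⟨(N ^ i + 1) * L, ?_, ?_⟩
  · have : (0 : ℝ) ≤ N ^ i := by positivity
    nlinarith
  intro Ω 𝔻 hADR h0 h x hx r hr
  have hrd : 0 < r ^ d := by positivity
  by_cases hrD : ENNReal.ofReal r < ediam (frontier Ω)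
  · refine (hADR x hx r hr hrD).2.trans (ENNReal.ofReal_le_ofReal ?_)
    refine mul_le_mul_of_nonneg_right ?_ hrd.le
    have : (0 : ℝ) ≤ N ^ i := by positivity
    nlinarith
  push Not at hrD
  have htop : ediam (frontier Ω) ≠ ⊤ := (hrD.trans_lt ENNReal.ofReal_lt_top).ne
  obtain ⟨k, -, hk, hΩ⟩ := h.exists_generation_eq_frontier hc₁ h0 htop
  set s : ℝ := c₁ * 2 ^ (-k) / 4 with hs
  have hs0 : 0 < s := by positivity
  have hsr : s ≤ r := by
    rw [← ENNReal.ofReal_le_ofReal_iff hr.le]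
    exact hk.le.trans hrD
  -- The ADR bound holds only below the diameter. The choice of `i` makes the cubes `i` generations
  -- further down fit into balls of the admissible radius `s`; the boundary is a union of at most `N
  -- ^ i` of them.
  have hP : ∀ P ∈ 𝔻 (k + i), surfaceMeasure d Ω P ≤ ENNReal.ofReal (L * r ^ d) := by
    intro P hP
    obtain ⟨z, hz, -, hz2⟩ := h.balls _ P hP
    refine (measure_mono (hz2.trans ?_)).trans ((hADR z hz s hs0 hk).2.trans ?_)
    · refine inter_subset_inter_left _ (ball_subset_ball ?_)
      rw [neg_add, zpow_add₀ two_ne_zero, zpow_neg _ (i : ℤ), zpow_natCast, hs]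
      rw [div_lt_iff₀ hc₁] at hi
      have h2 : (0 : ℝ) < 2 ^ (-k) := by positivity
      rw [← mul_assoc, ← div_eq_mul_inv, div_le_div_iff₀ (by positivity) (by norm_num)]
      nlinarith
    · refine ENNReal.ofReal_le_ofReal (mul_le_mul_of_nonneg_left ?_ (by linarith))
      exact Real.rpow_le_rpow hs0.le hsr hd.le
  have hQ := h.dyadicCube_mem k hx
  have hfin := h.measure_le_pow_mul _ i k hP _ hQ
  rw [hΩ k le_rfl _ hQ] at hfin
  refine (measure_mono inter_subset_right).trans (hfin.trans ?_)
  rw [← ENNReal.ofReal_natCast, ← ENNReal.ofReal_pow (by positivity),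
    ← ENNReal.ofReal_mul (by positivity), ← mul_assoc]
  refine ENNReal.ofReal_le_ofReal (mul_le_mul_of_nonneg_right ?_ hrd.le)
  exact mul_le_mul_of_nonneg_right (by linarith) (by linarith)

/-- Lower bound for the measure of a cube. -/
lemma IsDyadicSystem.ofReal_le_measure (h : IsDyadicSystem d Ω c₁ C₁ γ N 𝔻) {L : ℝ}
    (hADR : IsADRBoundary d L Ω) {k : ℤ} {P : Set (Ambient n)} (hP : P ∈ 𝔻 k) {s : ℝ}
    (hs : 0 < s) (hsk : s ≤ c₁ * 2 ^ (-k)) (hsD : ENNReal.ofReal s < ediam (frontier Ω)) :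
    ENNReal.ofReal (L⁻¹ * s ^ d) ≤ surfaceMeasure d Ω P := by
  obtain ⟨z, hz, hz1, -⟩ := h.balls k P hP
  exact (hADR z hz s hs hsD).1.trans
    (measure_mono ((inter_subset_inter_left _ (ball_subset_ball hsk)).trans hz1))

lemma IsDyadicSystem.measure_pos (h : IsDyadicSystem d Ω c₁ C₁ γ N 𝔻) {L : ℝ} (hL : 1 ≤ L)
    (hc₁ : 0 < c₁) (hADR : IsADRBoundary d L Ω) (h0 : 0 < ediam (frontier Ω)) {k : ℤ}
    {P : Set (Ambient n)} (hP : P ∈ 𝔻 k) : 0 < surfaceMeasure d Ω P := by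
  obtain ⟨D, hD0, hD⟩ : ∃ D : ℝ, 0 < D ∧ ENNReal.ofReal D < ediam (frontier Ω) := by
    obtain ⟨t, ht0, ht⟩ := ENNReal.lt_iff_exists_nnreal_btwn.1 h0
    exact ⟨t, by simpa using ht0, by simpa using ht⟩
  have hs : 0 < min D (c₁ * 2 ^ (-k)) := lt_min hD0 (by positivity)
  refine lt_of_lt_of_le ?_ (h.ofReal_le_measure hADR hP hs (min_le_right _ _)
    ((ENNReal.ofReal_le_ofReal (min_le_left _ _)).trans_lt hD))
  rw [ENNReal.ofReal_pos]
  positivity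

/-- Doubling: a surface ball of radius comparable to the side length of a cube has measure at most
comparable to that of the cube. -/
lemma exists_forall_surfaceBall_le_cube {L : ℝ} (hd : 0 < d) (hL : 1 ≤ L) (hc₁ : 0 < c₁)
    (C₁ γ : ℝ) (N : ℕ) (n : ℕ) {M : ℝ} (hM : 0 < M) :
    ∃ K : ℝ, 1 ≤ K ∧ ∀ (Ω : Set (Ambient n))
      (𝔻 : ℤ → Set (Set (Ambient n))), IsADRBoundary d L Ω → 0 < ediam (frontier Ω) →
      IsDyadicSystem d Ω c₁ C₁ γ N 𝔻 → ∀ k, ∀ P ∈ 𝔻 k, ∀ y ∈ frontier Ω,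
        surfaceMeasure d Ω (surfaceBall Ω y (M * 2 ^ (-k))) ≤
          ENNReal.ofReal K * surfaceMeasure d Ω P := by
  obtain ⟨L', hL', hup⟩ := exists_forall_surfaceBall_le hd hL hc₁ C₁ γ N n
  refine ⟨1 + L' * L * (2 * M / c₁) ^ d, ?_, ?_⟩
  · have : 0 ≤ L' * L * (2 * M / c₁) ^ d := by positivity
    linarith
  intro Ω 𝔻 hADR h0 h k P hP y hy
  -- Half the inner radius of `P`: either it is admissible for the lower ADR bound, or it is at
  -- least the diameter and the inner surface ball is already the whole boundary.
  set s : ℝ := c₁ * 2 ^ (-k) / 2 with hs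
  have hs0 : 0 < s := by positivity
  by_cases hsD : ENNReal.ofReal s < ediam (frontier Ω)
  · refine (hup Ω 𝔻 hADR h0 h y hy _ (by positivity)).trans ?_
    refine le_trans ?_ (mul_le_mul_right
      (h.ofReal_le_measure hADR hP hs0 (by rw [hs]; linarith [mul_pos hc₁ (zpow_pos (two_pos (α := ℝ)) (-k))]) hsD) _)
    rw [← ENNReal.ofReal_mul (by positivity)]
    refine ENNReal.ofReal_le_ofReal ?_
    have hsd : 0 < s ^ d := by positivity
    have h1 : M * 2 ^ (-k) = 2 * M / c₁ * s := by rw [hs]; field_simp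
    rw [h1, Real.mul_rpow (by positivity) hs0.le]
    calc L' * ((2 * M / c₁) ^ d * s ^ d) = L' * L * (2 * M / c₁) ^ d * (L⁻¹ * s ^ d) := by
          field_simp
      _ ≤ _ := mul_le_mul_of_nonneg_right (by linarith) (by positivity)
  · have hPΩ : frontier Ω ⊆ P := by
      obtain ⟨z, hz, hz1, -⟩ := h.balls k P hP
      intro x hx
      refine hz1 ⟨?_, hx⟩
      have h2 := (edist_le_ediam_of_mem hx hz).trans (not_lt.1 hsD)
      rw [edist_dist, ENNReal.ofReal_le_ofReal_iff hs0.le] at h2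
      have h3 : (0 : ℝ) < c₁ * 2 ^ (-k) := by positivity
      exact h2.trans_lt (by rw [hs]; linarith)
    refine (measure_mono (inter_subset_right.trans hPΩ)).trans
      (le_mul_of_one_le_left zero_le ?_)
    rw [ENNReal.one_le_ofReal]
    have : 0 ≤ L' * L * (2 * M / c₁) ^ d := by positivity
    linarith

/-- A set of measure zero off the boundary, and finite on surface balls, is locally finite. -/
lemma isLocallyFiniteMeasure_surfaceMeasure
    (hfin : ∀ x ∈ frontier Ω, ∀ r : ℝ, 0 < r → surfaceMeasure d Ω (surfaceBall Ω x r) < ⊤) :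
    IsLocallyFiniteMeasure (surfaceMeasure d Ω) := by
  refine ⟨fun x => ⟨ball x 1, ball_mem_nhds x one_pos, ?_⟩⟩
  have hres : surfaceMeasure d Ω (ball x 1) = surfaceMeasure d Ω (ball x 1 ∩ frontier Ω) := by
    rw [surfaceMeasure, Measure.restrict_apply measurableSet_ball,
      Measure.restrict_apply (measurableSet_ball.inter isClosed_frontier.measurableSet),
      inter_assoc, inter_self]
  rw [hres]
  rcases (ball x 1 ∩ frontier Ω).eq_empty_or_nonempty with he | ⟨y, hy, hyΩ⟩
  · simp [he]
  · refine (measure_mono ?_).trans_lt (hfin y hyΩ 2 two_pos)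
    refine inter_subset_inter_left _ (ball_subset_ball' ?_)
    rw [mem_ball, dist_comm] at hy
    linarith

end Measure

/-! ### Comparison of averages -/

section Averages

variable {E : Type*} [MeasurableSpace E] {μ : Measure E} {f : E → ℝ} {S B : Set E}

/-- The triangle inequality for integrals. Besides comparing averages, it bounds from below the `L¹`
distance of `f` to a constant far from its average, which drives the energy argument. -/
lemma enorm_average_sub_mul_le (h0 : μ S ≠ 0) (hT : μ S ≠ ⊤) (hf : IntegrableOn f S μ) (g : ℝ) :
    ‖⨍ y in S, f y ∂μ - g‖ₑ * μ S ≤ ∫⁻ y in S, ‖f y - g‖ₑ ∂μ := by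
  have hr : (0 : ℝ) < μ.real S := ENNReal.toReal_pos h0 hT
  have h1 : (⨍ y in S, f y ∂μ - g) * μ.real S = ∫ y in S, (f y - g) ∂μ := by
    rw [integral_sub hf (integrableOn_const hT), setAverage_eq, setIntegral_const, smul_eq_mul,
      smul_eq_mul]
    field_simp
  have h2 : ‖μ.real S‖ₑ = μ S := by
    rw [Real.enorm_of_nonneg hr.le]
    exact ENNReal.ofReal_toReal hT
  rw [← h2, ← enorm_mul, h1]
  exact enorm_integral_le_lintegral_enorm _

lemma abs_average_sub_le (h0 : μ S ≠ 0) (hT : μ S ≠ ⊤) (hf : IntegrableOn f S μ) {g t : ℝ}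
    (ht : 0 ≤ t) (h : ∫⁻ y in S, ‖f y - g‖ₑ ∂μ ≤ ENNReal.ofReal t * μ S) :
    |⨍ y in S, f y ∂μ - g| ≤ t := by
  have h1 := (enorm_average_sub_mul_le h0 hT hf g).trans h
  rw [ENNReal.mul_le_mul_iff_left h0 hT, Real.enorm_eq_ofReal_abs,
    ENNReal.ofReal_le_ofReal_iff ht] at h1
  exact h1

/-- Comparison of the averages over a set and over a larger one of comparable measure. -/
lemma abs_average_sub_le_of_subset (h0 : μ S ≠ 0) (hT : μ S ≠ ⊤) (hf : IntegrableOn f S μ)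
    {g t K : ℝ} (ht : 0 ≤ t) (hK : 0 ≤ K) (hSB : S ⊆ B)
    (hB : ∫⁻ y in B, ‖f y - g‖ₑ ∂μ ≤ ENNReal.ofReal t * μ B)
    (hBS : μ B ≤ ENNReal.ofReal K * μ S) : |⨍ y in S, f y ∂μ - g| ≤ K * t := by
  refine abs_average_sub_le h0 hT hf (by positivity) ?_
  refine (lintegral_mono_set hSB).trans (hB.trans ?_)
  rw [mul_comm K, ENNReal.ofReal_mul ht, mul_assoc]
  gcongr

lemma lintegral_sub_average_le (h0 : μ S ≠ 0) (hT : μ S ≠ ⊤) (hf : IntegrableOn f S μ)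
    {g t K : ℝ} (ht : 0 ≤ t) (hK : 0 ≤ K) (hSB : S ⊆ B)
    (hB : ∫⁻ y in B, ‖f y - g‖ₑ ∂μ ≤ ENNReal.ofReal t * μ B)
    (hBS : μ B ≤ ENNReal.ofReal K * μ S) :
    ∫⁻ y in S, ‖f y - ⨍ z in S, f z ∂μ‖ₑ ∂μ ≤ ENNReal.ofReal (2 * (K * t)) * μ S := by
  have h1 := abs_average_sub_le_of_subset h0 hT hf ht hK hSB hB hBS
  calc ∫⁻ y in S, ‖f y - ⨍ z in S, f z ∂μ‖ₑ ∂μ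
      ≤ ∫⁻ y in S, (‖f y - g‖ₑ + ENNReal.ofReal (K * t)) ∂μ := by
        refine lintegral_mono fun y => ?_
        rw [← sub_sub_sub_cancel_right _ _ g]
        refine (enorm_sub_le).trans (add_le_add le_rfl ?_)
        rw [Real.enorm_eq_ofReal_abs]
        exact ENNReal.ofReal_le_ofReal h1
    _ = ∫⁻ y in S, ‖f y - g‖ₑ ∂μ + ENNReal.ofReal (K * t) * μ S := by
        rw [lintegral_add_right _ measurable_const, setLIntegral_const]
    _ ≤ ENNReal.ofReal (K * t) * μ S + ENNReal.ofReal (K * t) * μ S := by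
        refine add_le_add_left ((lintegral_mono_set hSB).trans (hB.trans ?_)) _
        rw [mul_comm K, ENNReal.ofReal_mul ht, mul_assoc]
        gcongr
    _ = _ := by
        rw [two_mul, ENNReal.ofReal_add (by positivity) (by positivity), add_mul]

end Averages

/-! ### The stopped averages: packing of their changes, and convergence of averages -/

section Stopping

variable {n : ℕ} {d : ℝ} {Ω : Set (Ambient n)} {c₁ C₁ γ : ℝ} {N : ℕ}
  {𝔻 : ℤ → Set (Set (Ambient n))} {f : Ambient n → ℝ}

lemma lintegral_sub_average_surfaceBall_le (hf : MemBMO d Ω f) {x : Ambient n}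
    (hx : x ∈ frontier Ω) {r : ℝ} (hr : 0 < r)
    (hT : surfaceMeasure d Ω (surfaceBall Ω x r) ≠ ⊤) :
    ∫⁻ y in surfaceBall Ω x r, ‖f y - ⨍ z in surfaceBall Ω x r, f z ∂(surfaceMeasure d Ω)‖ₑ
        ∂(surfaceMeasure d Ω) ≤
      ENNReal.ofReal (bmoNorm d Ω f) * surfaceMeasure d Ω (surfaceBall Ω x r) := by
  rw [← measure_mul_setLAverage _ hT, mul_comm, bmoNorm, ENNReal.ofReal_toReal hf.2.ne]
  gcongr
  rw [bmoENorm]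
  exact le_iSup₂_of_le x hx (le_iSup₂_of_le r hr le_rfl)

/-- The average of `f` over the cube of generation `k` that contains `x`. -/
noncomputable def cubeAverage (d : ℝ) (Ω : Set (Ambient n)) (𝔻 : ℤ → Set (Set (Ambient n)))
    (f : Ambient n → ℝ) (k : ℤ) (x : Ambient n) : ℝ :=
  ⨍ y in dyadicCube 𝔻 k x, f y ∂(surfaceMeasure d Ω)

lemma IsDyadicSystem.isAdapted_cubeAverage (h : IsDyadicSystem d Ω c₁ C₁ γ N 𝔻) :
    IsAdapted Ω 𝔻 (cubeAverage d Ω 𝔻 f) := fun k x hx y hy => by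
  rw [cubeAverage, cubeAverage, h.dyadicCube_congr le_rfl hx hy]

/-- The values of an adapted process `φ` at the successive times when it has moved by more
than `τ`. -/
noncomputable def stoppedAux (φ : ℤ → Ambient n → ℝ) (k₁ : ℤ) (b₀ τ : ℝ) : ℕ → Ambient n → ℝ
  | 0, _ => b₀
  | i + 1, x =>
    open Classical in
    if |φ (k₁ + (i + 1 : ℕ)) x - stoppedAux φ k₁ b₀ τ i x| ≤ τ then stoppedAux φ k₁ b₀ τ i x
    else φ (k₁ + (i + 1 : ℕ)) x

/-- The recursion needs a first generation. The truncation `(k - k₁).toNat` extends the process by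
`b₀` to all coarser generations, where `h₁` makes `b₀` an admissible value. -/
lemma IsDyadicSystem.exists_stopped (h : IsDyadicSystem d Ω c₁ C₁ γ N 𝔻)
    {φ : ℤ → Ambient n → ℝ} (hφ : IsAdapted Ω 𝔻 φ) (k₁ : ℤ) (b₀ : ℝ) {τ : ℝ} (hτ : 0 ≤ τ)
    (h₁ : ∀ k ≤ k₁, ∀ x ∈ frontier Ω, |φ k x - b₀| ≤ τ) :
    ∃ b : ℤ → Ambient n → ℝ, IsAdapted Ω 𝔻 b ∧ (∀ k ≤ k₁, ∀ x, b k x = b₀) ∧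
      (∀ k, ∀ x ∈ frontier Ω, |φ k x - b k x| ≤ τ) ∧
      ∀ k x, b k x = b (k - 1) x ∨ (τ < |φ k x - b (k - 1) x| ∧ b k x = φ k x) := by
  have hle : ∀ k ≤ k₁, (k - k₁).toNat = 0 := fun k hk => by lia
  have hstep : ∀ i x, stoppedAux φ k₁ b₀ τ (i + 1) x = stoppedAux φ k₁ b₀ τ i x ∧
      |φ (k₁ + (i + 1 : ℕ)) x - stoppedAux φ k₁ b₀ τ i x| ≤ τ ∨
      (τ < |φ (k₁ + (i + 1 : ℕ)) x - stoppedAux φ k₁ b₀ τ i x| ∧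
        stoppedAux φ k₁ b₀ τ (i + 1) x = φ (k₁ + (i + 1 : ℕ)) x) := by
    intro i x
    by_cases hc : |φ (k₁ + (i + 1 : ℕ)) x - stoppedAux φ k₁ b₀ τ i x| ≤ τ
    · exact Or.inl ⟨by rw [stoppedAux, if_pos hc], hc⟩
    · exact Or.inr ⟨not_le.1 hc, by rw [stoppedAux, if_neg hc]⟩
  refine ⟨fun k => stoppedAux φ k₁ b₀ τ (k - k₁).toNat, ?_, ?_, ?_, ?_⟩
  · have key : ∀ i : ℕ, ∀ x ∈ frontier Ω, ∀ y ∈ dyadicCube 𝔻 (k₁ + i) x,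
        stoppedAux φ k₁ b₀ τ i y = stoppedAux φ k₁ b₀ τ i x := by
      intro i
      induction i with
      | zero => intro x _ y _; rfl
      | succ i ih =>
        intro x hx y hy
        rw [stoppedAux, stoppedAux, hφ _ x hx y hy,
          ih x hx y (h.dyadicCube_anti (by push_cast; lia) hx hy)]
    intro k x hx y hy
    rcases le_total k k₁ with hk | hk
    · simp only [hle k hk, stoppedAux]
    · exact key _ x hx y (by rwa [show k₁ + ((k - k₁).toNat : ℤ) = k by lia])
  · intro k hk x
    simp only [hle k hk, stoppedAux]
  · intro k x hx
    rcases le_total k k₁ with hk | hk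
    · simp only [hle k hk, stoppedAux]
      exact h₁ k hk x hx
    · obtain ⟨i, rfl⟩ : ∃ i : ℕ, k = k₁ + i := ⟨(k - k₁).toNat, by lia⟩
      simp only [add_sub_cancel_left, Int.toNat_natCast]
      rcases i with _ | i
      · exact h₁ _ (by simp) x hx
      · rcases hstep i x with ⟨h1, h2⟩ | ⟨-, h2⟩
        · rwa [h1]
        · rwa [h2, sub_self, abs_zero]
  · intro k x
    rcases le_or_gt k k₁ with hk | hk
    · left
      simp only [hle k hk, hle (k - 1) (by lia)]
    · obtain ⟨i, rfl⟩ : ∃ i : ℕ, k = k₁ + (i + 1 : ℕ) := ⟨(k - k₁ - 1).toNat, by lia⟩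
      have e1 : (k₁ + ((i + 1 : ℕ) : ℤ) - k₁).toNat = i + 1 := by lia
      have e2 : (k₁ + ((i + 1 : ℕ) : ℤ) - 1 - k₁).toNat = i := by lia
      simp only [e1, e2]
      exact (hstep i x).imp_left fun h => h.1

/-- One step of the energy argument: each change of the stopped process decreases the `L¹`
distance to `f`. -/
lemma IsDyadicSystem.lintegral_add_measure_changeSet_le (h : IsDyadicSystem d Ω c₁ C₁ γ N 𝔻)
    {b : ℤ → Ambient n → ℝ} {τ : ℝ} (hτ : 0 ≤ τ) (hb : IsAdapted Ω 𝔻 b)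
    (h0 : ∀ k, ∀ P ∈ 𝔻 k, surfaceMeasure d Ω P ≠ 0)
    (hT : ∀ k, ∀ P ∈ 𝔻 k, surfaceMeasure d Ω P ≠ ⊤)
    (hf : ∀ k, ∀ P ∈ 𝔻 k, IntegrableOn f P (surfaceMeasure d Ω))
    (hosc : ∀ k, ∀ x ∈ frontier Ω, ∫⁻ y in dyadicCube 𝔻 k x,
      ‖f y - cubeAverage d Ω 𝔻 f k x‖ₑ ∂(surfaceMeasure d Ω) ≤
        ENNReal.ofReal (τ / 2) * surfaceMeasure d Ω (dyadicCube 𝔻 k x))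
    (hstep : ∀ k x, b k x = b (k - 1) x ∨
      (τ < |cubeAverage d Ω 𝔻 f k x - b (k - 1) x| ∧ b k x = cubeAverage d Ω 𝔻 f k x))
    {l : ℤ} {D : Set (Ambient n)} (hD : IsCubeUnion Ω 𝔻 l D) :
    ∫⁻ y in D, ‖f y - b l y‖ₑ ∂(surfaceMeasure d Ω) +
        ENNReal.ofReal (τ / 2) * surfaceMeasure d Ω (D ∩ changeSet Ω b l) ≤
      ∫⁻ y in D, ‖f y - b (l - 1) y‖ₑ ∂(surfaceMeasure d Ω) := by
  set σ := surfaceMeasure d Ω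
  have hmeas : MeasurableSet (changeSet Ω b l) := (h.isCubeUnion_changeSet hb l).measurableSet h
  have hch : ∀ S, σ (S ∩ changeSet Ω b l) = ∫⁻ y in S, (changeSet Ω b l).indicator 1 y ∂σ := by
    intro S
    rw [lintegral_indicator_one hmeas, Measure.restrict_apply hmeas, inter_comm]
  rw [hch, hD.lintegral_eq_tsum h σ, hD.lintegral_eq_tsum h σ, hD.lintegral_eq_tsum h σ,
    ← ENNReal.tsum_mul_left, ← ENNReal.tsum_add]
  refine ENNReal.tsum_le_tsum ?_
  rintro ⟨S, hS, -⟩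
  dsimp only
  rw [← hch]
  rcases S.eq_empty_or_nonempty with rfl | ⟨x, hx⟩
  · simp
  have hxΩ := h.subset_frontier hS hx
  have hSx : dyadicCube 𝔻 l x = S := h.dyadicCube_eq hS hx
  have hcong : ∀ k ≤ l, ∫⁻ y in S, ‖f y - b k y‖ₑ ∂σ = ∫⁻ y in S, ‖f y - b k x‖ₑ ∂σ := by
    intro k hk
    refine setLIntegral_congr_fun (h.borel l S hS) fun y hy => ?_
    rw [hb k x hxΩ y (h.dyadicCube_anti hk hxΩ (hSx.symm ▸ hy))]
  rw [hcong l le_rfl, hcong (l - 1) (by lia)]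
  rcases hstep l x with hc | ⟨hc, hbφ⟩
  · have : S ∩ changeSet Ω b l = ∅ := by
      refine eq_empty_of_forall_notMem fun y hy => hy.2.2 ?_
      have hyx : y ∈ dyadicCube 𝔻 l x := hSx.symm ▸ hy.1
      rw [hb l x hxΩ y hyx, hb (l - 1) x hxΩ y (h.dyadicCube_anti (by lia) hxΩ hyx), hc]
    rw [this, measure_empty, mul_zero, add_zero, hc]
  -- The old constant is more than `τ` from the average, so its `L¹` distance to `f` is at least `τ
  -- * σ S`. For the new one, the average itself, the distance is at most `τ / 2 * σ S`. The gap
  -- pays for the change.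
  · have h1 := hosc l x hxΩ
    have h2 := enorm_average_sub_mul_le (h0 l S hS) (hT l S hS) (hf l S hS) (b (l - 1) x)
    rw [hSx] at h1
    have h3 : cubeAverage d Ω 𝔻 f l x = ⨍ y in S, f y ∂σ := by rw [cubeAverage, hSx]
    rw [hbφ]
    calc _ ≤ ENNReal.ofReal (τ / 2) * σ S + ENNReal.ofReal (τ / 2) * σ S :=
          add_le_add h1 (mul_le_mul_right (measure_mono inter_subset_left) _)
      _ = ENNReal.ofReal τ * σ S := by
          rw [← add_mul, ← ENNReal.ofReal_add (by positivity) (by positivity), add_halves]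
      _ ≤ ‖⨍ y in S, f y ∂σ - b (l - 1) x‖ₑ * σ S := by
          rw [← h3, Real.enorm_eq_ofReal_abs]
          gcongr
      _ ≤ _ := h2

/-- The change sets of the stopped process satisfy a packing condition. -/
lemma IsDyadicSystem.tsum_measure_changeSet_stopped_le (h : IsDyadicSystem d Ω c₁ C₁ γ N 𝔻)
    {b : ℤ → Ambient n → ℝ} {τ : ℝ} (hτ : 0 < τ) (hb : IsAdapted Ω 𝔻 b)
    (h0 : ∀ k, ∀ P ∈ 𝔻 k, surfaceMeasure d Ω P ≠ 0)
    (hT : ∀ k, ∀ P ∈ 𝔻 k, surfaceMeasure d Ω P ≠ ⊤)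
    (hf : ∀ k, ∀ P ∈ 𝔻 k, IntegrableOn f P (surfaceMeasure d Ω))
    (hosc : ∀ k, ∀ x ∈ frontier Ω, ∫⁻ y in dyadicCube 𝔻 k x,
      ‖f y - cubeAverage d Ω 𝔻 f k x‖ₑ ∂(surfaceMeasure d Ω) ≤
        ENNReal.ofReal (τ / 2) * surfaceMeasure d Ω (dyadicCube 𝔻 k x))
    (hclose : ∀ k, ∀ x ∈ frontier Ω, |cubeAverage d Ω 𝔻 f k x - b k x| ≤ τ)
    (hstep : ∀ k x, b k x = b (k - 1) x ∨
      (τ < |cubeAverage d Ω 𝔻 f k x - b (k - 1) x| ∧ b k x = cubeAverage d Ω 𝔻 f k x))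
    {m : ℤ} {R : Set (Ambient n)} (hR : R ∈ 𝔻 m) :
    ∑' p : ℕ, surfaceMeasure d Ω (R ∩ changeSet Ω b (m + p + 1)) ≤
      3 * surfaceMeasure d Ω R := by
  set σ := surfaceMeasure d Ω
  rcases R.eq_empty_or_nonempty with rfl | ⟨x, hx⟩
  · simp
  have hxΩ := h.subset_frontier hR hx
  have hRx : dyadicCube 𝔻 m x = R := h.dyadicCube_eq hR hx
  -- The initial energy is at most `(τ / 2 + τ) * σ R`, three times the unit `τ / 2 * σ R` that the
  -- changes are charged in; hence the 3.
  have hstart : ∫⁻ y in R, ‖f y - b m y‖ₑ ∂σ ≤ ENNReal.ofReal (τ / 2) * (3 * σ R) := by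
    have hosc' := hosc m x hxΩ
    rw [hRx] at hosc'
    calc ∫⁻ y in R, ‖f y - b m y‖ₑ ∂σ
        ≤ ∫⁻ y in R, (‖f y - cubeAverage d Ω 𝔻 f m x‖ₑ + ENNReal.ofReal τ) ∂σ := by
          refine setLIntegral_mono' (h.borel m R hR) fun y hy => ?_
          rw [hb m x hxΩ y (hRx.symm ▸ hy),
            ← sub_add_sub_cancel (f y) (cubeAverage d Ω 𝔻 f m x) (b m x)]
          refine (enorm_add_le _ _).trans (add_le_add le_rfl ?_)
          rw [Real.enorm_eq_ofReal_abs]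
          exact ENNReal.ofReal_le_ofReal (hclose m x hxΩ)
      _ = ∫⁻ y in R, ‖f y - cubeAverage d Ω 𝔻 f m x‖ₑ ∂σ + ENNReal.ofReal τ * σ R := by
          rw [lintegral_add_right _ measurable_const, setLIntegral_const]
      _ ≤ ENNReal.ofReal (τ / 2) * σ R + ENNReal.ofReal τ * σ R := add_le_add_left hosc' _
      _ = ENNReal.ofReal (τ / 2) * (3 * σ R) := by
          rw [← mul_assoc, ← add_mul, ← ENNReal.ofReal_add (by positivity) hτ.le,
            show (3 : ENNReal) = ENNReal.ofReal 3 by simp,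
            ← ENNReal.ofReal_mul (by positivity)]
          congr 2
          ring
  have hiter : ∀ q : ℕ, ∑ p ∈ Finset.range q,
      ENNReal.ofReal (τ / 2) * σ (R ∩ changeSet Ω b (m + p + 1)) +
        ∫⁻ y in R, ‖f y - b (m + q) y‖ₑ ∂σ ≤ ∫⁻ y in R, ‖f y - b m y‖ₑ ∂σ := by
    intro q
    induction q with
    | zero => simp
    | succ q ih =>
      have hs := h.lintegral_add_measure_changeSet_le hτ.le hb h0 hT hf hosc hstep
        ((IsCubeUnion.of_mem h hR).mono h (by lia : m ≤ m + q + 1))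
      rw [add_sub_cancel_right] at hs
      rw [Finset.sum_range_succ, add_assoc]
      refine le_trans (add_le_add_right ?_ _) ih
      rw [add_comm]
      push_cast
      rwa [← add_assoc]
  have hτ0 : ENNReal.ofReal (τ / 2) ≠ 0 := by
    rw [Ne, ENNReal.ofReal_eq_zero, not_le]
    positivity
  rw [← ENNReal.mul_le_mul_iff_right hτ0 ENNReal.ofReal_ne_top, ← ENNReal.tsum_mul_left]
  rw [ENNReal.tsum_eq_iSup_nat]
  exact iSup_le fun q => (le_self_add.trans (hiter q)).trans hstart

/-- Cube averages converge almost everywhere. -/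
lemma IsDyadicSystem.ae_tendsto_cubeAverage (h : IsDyadicSystem d Ω c₁ C₁ γ N 𝔻)
    (hC₁ : 1 ≤ C₁) [IsLocallyFiniteMeasure (surfaceMeasure d Ω)]
    (h0 : ∀ k, ∀ P ∈ 𝔻 k, surfaceMeasure d Ω P ≠ 0)
    (hT : ∀ k, ∀ P ∈ 𝔻 k, surfaceMeasure d Ω P ≠ ⊤)
    (hf : LocallyIntegrable f (surfaceMeasure d Ω)) {K : ℝ}
    (hK : ∀ k, ∀ P ∈ 𝔻 k, ∀ y ∈ frontier Ω,
        surfaceMeasure d Ω (surfaceBall Ω y (3 * C₁ * 2 ^ (-k))) ≤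
          ENNReal.ofReal K * surfaceMeasure d Ω P) :
    ∀ᵐ x ∂(surfaceMeasure d Ω),
      Tendsto (fun k => cubeAverage d Ω 𝔻 f k x) atTop (𝓝 (f x)) := by
  set σ := surfaceMeasure d Ω
  have hmem : ∀ᵐ x ∂σ, x ∈ frontier Ω :=
    ae_restrict_mem isClosed_frontier.measurableSet
  -- Lebesgue differentiation is applied to closed balls centred at `x`. By doubling, the cube about
  -- `x` fills a fixed proportion of such a ball, so its average is controlled by that over the
  -- ball. The radius `3 * C₁` in `hK` leaves room to pass from closed to open balls.
  filter_upwards [(Besicovitch.vitaliFamily σ).ae_tendsto_average_norm_sub hf, hmem] with x hx hxΩ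
  have hrad : Tendsto (fun k : ℤ => 2 * C₁ * (2 : ℝ) ^ (-k)) atTop (𝓝[>] 0) := by
    refine tendsto_nhdsWithin_iff.2 ⟨?_, Eventually.of_forall fun k => ?_⟩
    · have h1 : Tendsto (fun k : ℤ => (2 : ℝ) ^ (-k)) atTop (𝓝 0) := by
        rw [← Nat.map_cast_int_atTop, tendsto_map'_iff]
        refine (tendsto_pow_atTop_nhds_zero_of_lt_one (r := (2 : ℝ)⁻¹) (by norm_num)
          (by norm_num)).congr fun k => ?_
        simp
      simpa using h1.const_mul (2 * C₁)
    · have : (0 : ℝ) < 2 ^ (-k) := by positivity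
      exact mem_Ioi.2 (by positivity)
  have hlim := (hx.comp ((Besicovitch.tendsto_filterAt σ x).comp hrad)).const_mul (max K 0)
  rw [mul_zero] at hlim
  rw [tendsto_iff_norm_sub_tendsto_zero]
  refine squeeze_zero (fun k => norm_nonneg _) (fun k => ?_) hlim
  set P := dyadicCube 𝔻 k x
  have hP : P ∈ 𝔻 k := h.dyadicCube_mem k hxΩ
  set B := closedBall x (2 * C₁ * (2 : ℝ) ^ (-k)) with hBdef
  have hPB : P ⊆ B := fun y hy => h.dist_le_of_mem_dyadicCube hxΩ hy
  have hBT : σ B ≠ ⊤ := (isCompact_closedBall _ _).measure_lt_top.ne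
  have hB0 : σ B ≠ 0 := fun hz => h0 k P hP (measure_mono_null hPB hz)
  have hfB : IntegrableOn f B σ := hf.integrableOn_isCompact (isCompact_closedBall _ _)
  have hint : IntegrableOn (fun y => ‖f y - f x‖) B σ :=
    (hfB.sub (integrableOn_const hBT)).norm
  have hav0 : 0 ≤ ⨍ y in B, ‖f y - f x‖ ∂σ := by
    rw [setAverage_eq]
    exact smul_nonneg (by positivity) (integral_nonneg fun y => norm_nonneg _)
  have hBP : σ B ≤ ENNReal.ofReal (max K 0) * σ P := by
    have hres : σ B = σ (B ∩ frontier Ω) := by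
      simp only [σ, surfaceMeasure]
      rw [Measure.restrict_apply measurableSet_closedBall,
        Measure.restrict_apply (measurableSet_closedBall.inter isClosed_frontier.measurableSet),
        inter_assoc, inter_self]
    rw [hres]
    refine (measure_mono ?_).trans ((hK k P hP x hxΩ).trans ?_)
    · refine inter_subset_inter_left _ (closedBall_subset_ball ?_)
      have : (0 : ℝ) < 2 ^ (-k) := by positivity
      nlinarith
    · gcongr
      exact le_max_left _ _
  refine abs_average_sub_le_of_subset (B := B) (h0 k P hP) (hT k P hP) (hfB.mono_set hPB) hav0
    (le_max_right _ _) hPB ?_ hBP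
  have h1 : ∫⁻ y in B, ‖f y - f x‖ₑ ∂σ = ENNReal.ofReal (∫ y in B, ‖f y - f x‖ ∂σ) := by
    rw [ofReal_integral_eq_lintegral_ofReal hint (Eventually.of_forall fun y => norm_nonneg _)]
    exact lintegral_congr fun y => (ofReal_norm _).symm
  rw [h1]
  have h2 : σ B = ENNReal.ofReal (σ.real B) := (ENNReal.ofReal_toReal hBT).symm
  change _ ≤ ENNReal.ofReal (⨍ y in B, ‖f y - f x‖ ∂σ) * _
  rw [h2, ← ENNReal.ofReal_mul hav0]
  refine ENNReal.ofReal_le_ofReal (le_of_eq ?_)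
  have hr : (0 : ℝ) < σ.real B := ENNReal.toReal_pos hB0 hBT
  rw [setAverage_eq, smul_eq_mul]
  field_simp

end Stopping

/-! ### Partial sums of the series, and the coarse generations -/

section CubeSum

variable {n : ℕ} {d : ℝ} {Ω : Set (Ambient n)} {c₁ C₁ γ : ℝ} {N : ℕ}
  {𝔻 : ℤ → Set (Set (Ambient n))} {f : Ambient n → ℝ} {ι : Type*}
  {Q : ι → Set (Ambient n)} {α : ι → ℝ}

open Classical in
/-- The sum of the coefficients of the members of the family that contain the cube of
generation `k` about `x`. -/
noncomputable def cubeSum (𝔻 : ℤ → Set (Set (Ambient n))) (Q : ι → Set (Ambient n)) (α : ι → ℝ)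
    (k : ℤ) (x : Ambient n) : ℝ :=
  ∑' j, if dyadicCube 𝔻 k x ⊆ Q j then α j else 0

/-- The points whose cube of generation `k` is a member of the family, and is not already a cube
of generation `k - 1`. -/
def newCubeSet (Ω : Set (Ambient n)) (𝔻 : ℤ → Set (Set (Ambient n)))
    (Q : ι → Set (Ambient n)) (k : ℤ) : Set (Ambient n) :=
  {x ∈ frontier Ω | ∃ j, Q j = dyadicCube 𝔻 k x ∧ dyadicCube 𝔻 k x ≠ dyadicCube 𝔻 (k - 1) x}

/-- The index type of the family is arbitrary; packing and the positivity of the measures of cubes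
supply the countability that the union bounds need. -/
lemma countable_of_tsum_measure_ne_top {E κ : Type*} [MeasurableSpace E] {μ : Measure E}
    {S : κ → Set E} (h0 : ∀ j, μ (S j) ≠ 0) (hfin : ∑' j, μ (S j) ≠ ⊤) : Countable κ := by
  have hs : (Function.support fun j => μ (S j)) = univ := eq_univ_of_forall h0
  have := Summable.countable_support_ennreal hfin
  rw [hs] at this
  exact countable_univ_iff.1 this

namespace IsDyadicSystem

lemma isAdapted_cubeSum (h : IsDyadicSystem d Ω c₁ C₁ γ N 𝔻) :
    IsAdapted Ω 𝔻 (cubeSum 𝔻 Q α) := fun k x hx y hy => by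
  rw [cubeSum, cubeSum, h.dyadicCube_congr le_rfl hx hy]

/-- Unless the cube is a new member of the family, each `Q j` contains it exactly when it contains
its parent. The two series then agree term by term, so summability plays no role. -/
lemma changeSet_cubeSum_subset (h : IsDyadicSystem d Ω c₁ C₁ γ N 𝔻)
    (hQ : ∀ j, ∃ k, Q j ∈ 𝔻 k) (k : ℤ) :
    changeSet Ω (cubeSum 𝔻 Q α) k ⊆ newCubeSet Ω 𝔻 Q k := by
  classical
  rintro x ⟨hx, hne⟩
  refine ⟨hx, ?_⟩
  by_contra! hcon
  refine hne (tsum_congr fun j => ?_)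
  have hsub : dyadicCube 𝔻 k x ⊆ dyadicCube 𝔻 (k - 1) x := h.dyadicCube_anti (by lia) hx
  have hiff : dyadicCube 𝔻 k x ⊆ Q j ↔ dyadicCube 𝔻 (k - 1) x ⊆ Q j := by
    refine ⟨fun hj => ?_, fun hj => hsub.trans hj⟩
    obtain ⟨i, hi⟩ := hQ j
    have hxj := hj (h.mem_dyadicCube k hx)
    rcases le_or_gt i (k - 1) with hik | hik
    · exact h.dyadicCube_subset hik hi hxj
    · have hji : Q j ⊆ dyadicCube 𝔻 k x := by
        rw [← h.dyadicCube_eq hi hxj]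
        exact h.dyadicCube_anti (by lia) hx
      rw [← hcon j (hji.antisymm hj)]
      exact hj
  exact if_congr hiff rfl rfl

/-- The new cubes inherit the packing condition of the family. -/
lemma tsum_measure_newCubeSet_le (h : IsDyadicSystem d Ω c₁ C₁ γ N 𝔻)
    (h0 : ∀ k, ∀ P ∈ 𝔻 k, surfaceMeasure d Ω P ≠ 0)
    (hQ : ∀ j, ∃ k, Q j ∈ 𝔻 k) {m : ℤ} {R : Set (Ambient n)} (hR : R ∈ 𝔻 m)
    (hfin : ∑' j : {j : ι // Q j ⊆ R}, surfaceMeasure d Ω (Q j) ≠ ⊤) :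
    ∑' p : ℕ, surfaceMeasure d Ω (R ∩ newCubeSet Ω 𝔻 Q (m + p + 1)) ≤
      ∑' j : {j : ι // Q j ⊆ R}, surfaceMeasure d Ω (Q j) := by
  classical
  set σ := surfaceMeasure d Ω
  have hcount : Countable {j : ι // Q j ⊆ R} :=
    countable_of_tsum_measure_ne_top (fun j => (hQ j).elim fun k hk => h0 k _ hk) hfin
  let p' : ℕ → {j : ι // Q j ⊆ R} → Prop := fun p j =>
    ∃ x ∈ frontier Ω, Q j = dyadicCube 𝔻 (m + p + 1) x ∧
      dyadicCube 𝔻 (m + p + 1) x ≠ dyadicCube 𝔻 (m + p) x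
  have h1 : ∀ p : ℕ, σ (R ∩ newCubeSet Ω 𝔻 Q (m + p + 1)) ≤
      ∑' j : {j : ι // Q j ⊆ R}, if p' p j then σ (Q j) else 0 := by
    intro p
    have hsub : R ∩ newCubeSet Ω 𝔻 Q (m + p + 1) ⊆
        ⋃ j : {j : ι // Q j ⊆ R}, if p' p j then Q j else ∅ := by
      rintro x ⟨hxR, hx, j, hj, hne⟩
      rw [add_sub_cancel_right] at hne
      have hjR : Q j ⊆ R := by
        rw [hj]
        exact h.dyadicCube_subset (by lia) hR hxR
      refine mem_iUnion.2 ⟨⟨j, hjR⟩, ?_⟩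
      rw [if_pos ⟨x, hx, hj, hne⟩]
      change x ∈ Q j
      rw [hj]
      exact h.mem_dyadicCube _ hx
    refine (measure_mono hsub).trans ((measure_iUnion_le _).trans (ENNReal.tsum_le_tsum fun j => ?_))
    split_ifs <;> simp
  have h2 : ∀ j : {j : ι // Q j ⊆ R}, ∑' p : ℕ, (if p' p j then σ (Q j) else 0) ≤ σ (Q j) := by
    intro j
    -- One set may be a cube of several generations. Requiring it to differ from its parent leaves
    -- at most one generation, so each `Q j` is charged once.
    have huniq : ∀ p q : ℕ, p < q → p' p j → ¬ p' q j := by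
      rintro p q hpq ⟨x, hx, hjx, -⟩ ⟨y, hy, hjy, hne⟩
      have hyj : y ∈ Q j := hjy ▸ h.mem_dyadicCube _ hy
      have hP : Q j ∈ 𝔻 (m + p + 1) := hjx ▸ h.dyadicCube_mem _ hx
      refine hne ((h.dyadicCube_anti (by lia) hy).antisymm ?_)
      rw [← hjy]
      exact h.dyadicCube_subset (by lia) hP hyj
    by_cases hex : ∃ p, p' p j
    · obtain ⟨p, hp⟩ := hex
      rw [tsum_eq_single p, if_pos hp]
      intro q hq
      rw [if_neg]
      intro hqj
      rcases lt_or_gt_of_ne hq with hlt | hlt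
      · exact huniq q p hlt hqj hp
      · exact huniq p q hlt hp hqj
    · push Not at hex
      simp [hex]
  calc _ ≤ ∑' (p : ℕ) (j : {j : ι // Q j ⊆ R}), (if p' p j then σ (Q j) else 0) :=
        ENNReal.tsum_le_tsum h1
    _ = ∑' (j : {j : ι // Q j ⊆ R}) (p : ℕ), (if p' p j then σ (Q j) else 0) := ENNReal.tsum_comm
    _ ≤ _ := ENNReal.tsum_le_tsum h2

/-- The partial sums reach the value of the series almost everywhere. -/
lemma ae_eventually_cubeSum_eq (h : IsDyadicSystem d Ω c₁ C₁ γ N 𝔻)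
    (h0 : ∀ k, ∀ P ∈ 𝔻 k, surfaceMeasure d Ω P ≠ 0)
    (hQ : ∀ j, ∃ k, Q j ∈ 𝔻 k) (hfin : ∑' j, surfaceMeasure d Ω (Q j) ≠ ⊤)
    (hf : ∀ᵐ x ∂(surfaceMeasure d Ω), HasSum (fun j => (Q j).indicator (fun _ => α j) x) (f x)) :
    ∀ᵐ x ∂(surfaceMeasure d Ω), ∀ᶠ k in atTop, cubeSum 𝔻 Q α k x = f x := by
  classical
  have hmem : ∀ᵐ x ∂(surfaceMeasure d Ω), x ∈ frontier Ω :=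
    ae_restrict_mem isClosed_frontier.measurableSet
  have hcount : Countable ι :=
    countable_of_tsum_measure_ne_top (fun j => (hQ j).elim fun k hk => h0 k _ hk) hfin
  filter_upwards [hf, hmem, ae_finite_setOfPred_mem hfin] with x hx hxΩ hxfin
  -- Almost every `x` lies in finitely many `Q j`, by Borel–Cantelli. Beyond the generations of
  -- these, containing the cube about `x` and containing `x` are the same.
  choose g hg using hQ
  obtain ⟨K, hK⟩ := (hxfin.image g).bddAbove
  filter_upwards [eventually_ge_atTop K] with k hk
  rw [← hx.tsum_eq]
  refine tsum_congr fun j => ?_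
  have hiff : dyadicCube 𝔻 k x ⊆ Q j ↔ x ∈ Q j := by
    refine ⟨fun hj => hj (h.mem_dyadicCube k hxΩ), fun hj => ?_⟩
    exact h.dyadicCube_subset ((hK (mem_image_of_mem g hj)).trans hk) (hg j) hj
  simp only [hiff, indicator_apply]

/-- The coarse generations, on which the averages and the partial sums are nearly constant. -/
lemma exists_coarse_generation (h : IsDyadicSystem d Ω c₁ C₁ γ N 𝔻) {L : ℝ} (hd : 0 < d)
    (hL : 1 ≤ L) (hc₁ : 0 < c₁) (hADR : IsADRBoundary d L Ω) (hdiam : 0 < ediam (frontier Ω))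
    {Q₀ : Set (Ambient n)} {k₀ : ℤ} (hQ₀ : Q₀ ∈ 𝔻 k₀) (hQ : ∀ j, Q j ⊆ Q₀)
    (hT : ∀ k, ∀ P ∈ 𝔻 k, surfaceMeasure d Ω P ≠ ⊤)
    (hint : ∀ k, ∀ P ∈ 𝔻 k, IntegrableOn f P (surfaceMeasure d Ω))
    (hf : ∀ᵐ x ∂(surfaceMeasure d Ω), HasSum (fun j => (Q j).indicator (fun _ => α j) x) (f x))
    {τ : ℝ} (hτ : 0 < τ) :
    ∃ (k₁ : ℤ) (b₀ s₀ : ℝ), (∀ k ≤ k₁, ∀ x ∈ frontier Ω,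
        |cubeAverage d Ω 𝔻 f k x - b₀| ≤ τ ∧ cubeSum 𝔻 Q α k x = s₀) ∧
      ∀ k, k₁ - 1 ≤ k → ∀ P ∈ 𝔻 k,
        ENNReal.ofReal (L⁻¹ * (c₁ / 8) ^ d * (2 ^ (-k)) ^ d) ≤ surfaceMeasure d Ω P := by
  classical
  set σ := surfaceMeasure d Ω
  -- In the bounded case `c₁ * 2 ^ (-k₁) / 4` is below the diameter; the divisor 8 accommodates the
  -- one coarser generation `k₁ - 1`.
  have hlow : ∀ k, ENNReal.ofReal (c₁ * 2 ^ (-k) / 8) < ediam (frontier Ω) → ∀ P ∈ 𝔻 k,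
      ENNReal.ofReal (L⁻¹ * (c₁ / 8) ^ d * (2 ^ (-k)) ^ d) ≤ σ P := by
    intro k hk P hP
    have hpos : (0 : ℝ) < c₁ * 2 ^ (-k) := by positivity
    have := h.ofReal_le_measure hADR hP (by positivity) (by linarith) hk
    rwa [show c₁ * (2 : ℝ) ^ (-k) / 8 = c₁ / 8 * 2 ^ (-k) by ring,
      Real.mul_rpow (by positivity) (by positivity), ← mul_assoc] at this
  by_cases htop : ediam (frontier Ω) = ⊤
  · have hlow' : ∀ k, ∀ P ∈ 𝔻 k,
        ENNReal.ofReal (L⁻¹ * (c₁ / 8) ^ d * (2 ^ (-k)) ^ d) ≤ σ P := fun k =>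
      hlow k (by rw [htop]; exact ENNReal.ofReal_lt_top)
    set I := ∫⁻ y in Q₀, ‖f y‖ₑ ∂σ with hI
    have hIT : I ≠ ⊤ := (hint k₀ Q₀ hQ₀).2.ne
    have hτ0 : ENNReal.ofReal τ ≠ 0 := (ENNReal.ofReal_pos.2 hτ).ne'
    -- On an unbounded boundary, cubes of measure above this threshold have average at most `τ` in
    -- absolute value, by the first term, and are too large to lie in any `Q j`, by the second.
    have hWT : I / ENNReal.ofReal τ + σ Q₀ ≠ ⊤ :=
      ENNReal.add_ne_top.2 ⟨ENNReal.div_ne_top hIT hτ0, hT k₀ Q₀ hQ₀⟩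
    set W := (I / ENNReal.ofReal τ + σ Q₀).toReal
    have hW : I / ENNReal.ofReal τ + σ Q₀ = ENNReal.ofReal W := (ENNReal.ofReal_toReal hWT).symm
    have hκ : 0 < L⁻¹ * (c₁ / 8) ^ d := by positivity
    obtain ⟨k₁, hk₁⟩ : ∃ k₁ : ℤ, ∀ k ≤ k₁, W < L⁻¹ * (c₁ / 8) ^ d * (2 ^ (-k)) ^ d := by
      obtain ⟨u, hu⟩ := ((tendsto_rpow_atTop hd).const_mul_atTop hκ).eventually_gt_atTop W
        |>.exists_forall_of_atTop
      obtain ⟨i, hi⟩ := pow_unbounded_of_one_lt u (one_lt_two (α := ℝ))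
      refine ⟨-i, fun k hk => hu _ (hi.le.trans ?_)⟩
      rw [← zpow_natCast]
      exact zpow_le_zpow_right₀ one_le_two (by lia)
    have hbig : ∀ k ≤ k₁, ∀ P ∈ 𝔻 k, I / ENNReal.ofReal τ + σ Q₀ < σ P := by
      intro k hk P hP
      refine lt_of_lt_of_le ?_ (hlow' k P hP)
      rw [hW]
      exact (ENNReal.ofReal_lt_ofReal_iff (by positivity)).2 (hk₁ k hk)
    refine ⟨k₁, 0, 0, fun k hk x hx => ?_, fun k _ P hP => hlow' k P hP⟩
    set P := dyadicCube 𝔻 k x with hPdef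
    have hP : P ∈ 𝔻 k := h.dyadicCube_mem k hx
    have hPb := hbig k hk P hP
    constructor
    · refine abs_average_sub_le (zero_le.trans_lt hPb).ne' (hT k P hP) (hint k P hP) hτ.le ?_
      have hz : ∀ᵐ y ∂σ, ‖f y‖ₑ = Q₀.indicator (fun y => ‖f y‖ₑ) y := by
        filter_upwards [hf] with y hy
        by_cases hyQ : y ∈ Q₀
        · rw [indicator_of_mem hyQ]
        · have h1 : (fun j => (Q j).indicator (fun _ => α j) y) = fun _ => 0 := by
            funext j
            exact indicator_of_notMem (fun hc => hyQ (hQ j hc)) _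
          rw [h1] at hy
          rw [indicator_of_notMem hyQ, hy.unique hasSum_zero, enorm_zero]
      calc ∫⁻ y in P, ‖f y - 0‖ₑ ∂σ ≤ ∫⁻ y, ‖f y‖ₑ ∂σ := by
            simp only [sub_zero]
            exact setLIntegral_le_lintegral _ _
        _ = I := by rw [lintegral_congr_ae hz, lintegral_indicator (h.borel k₀ Q₀ hQ₀)]
        _ = ENNReal.ofReal τ * (I / ENNReal.ofReal τ) :=
            (ENNReal.mul_div_cancel hτ0 ENNReal.ofReal_ne_top).symm
        _ ≤ _ := mul_le_mul_right (le_self_add.trans hPb.le) _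
    · have hj : ∀ j, ¬ P ⊆ Q j := fun j hj =>
        (lt_of_le_of_lt le_add_self hPb).not_ge (measure_mono (hj.trans (hQ j)))
      simp only [cubeSum, ← hPdef, hj, if_false, tsum_zero]
  · obtain ⟨k₁, -, hk₁, hall⟩ := h.exists_generation_eq_frontier hc₁ hdiam htop
    refine ⟨k₁, ⨍ y in frontier Ω, f y ∂σ, ∑' j, if frontier Ω ⊆ Q j then α j else 0,
      fun k hk x hx => ?_, fun k hk => hlow k (lt_of_le_of_lt ?_ hk₁)⟩
    · have hP := hall k hk _ (h.dyadicCube_mem k hx)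
      rw [cubeAverage, cubeSum, hP, sub_self, abs_zero]
      exact ⟨hτ.le, rfl⟩
    · refine ENNReal.ofReal_le_ofReal ?_
      have : (2 : ℝ) ^ (-k) ≤ 2 ^ (-k₁ + 1) := zpow_le_zpow_right₀ one_le_two (by lia)
      rw [zpow_add_one₀ two_ne_zero] at this
      nlinarith

end IsDyadicSystem

end CubeSum

/-! ### The approximating process -/

section Approximation

lemma IsDyadicSystem.measure_ne_top {n : ℕ} {d : ℝ} {Ω : Set (Ambient n)} {c₁ C₁ γ : ℝ} {N : ℕ}
    {𝔻 : ℤ → Set (Set (Ambient n))} (h : IsDyadicSystem d Ω c₁ C₁ γ N 𝔻) (hC₁ : 1 ≤ C₁)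
    (hfin : ∀ x ∈ frontier Ω, ∀ r : ℝ, 0 < r → surfaceMeasure d Ω (surfaceBall Ω x r) < ⊤)
    {k : ℤ} {P : Set (Ambient n)} (hP : P ∈ 𝔻 k) : surfaceMeasure d Ω P ≠ ⊤ := by
  obtain ⟨z, hz, -, hzP⟩ := h.balls k P hP
  exact ((measure_mono hzP).trans_lt (hfin z hz _ (by positivity))).ne

lemma IsDyadicSystem.integrableOn {n : ℕ} {d : ℝ} {Ω : Set (Ambient n)} {c₁ C₁ γ : ℝ} {N : ℕ}
    {𝔻 : ℤ → Set (Set (Ambient n))} (h : IsDyadicSystem d Ω c₁ C₁ γ N 𝔻) {f : Ambient n → ℝ}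
    (hf : LocallyIntegrable f (surfaceMeasure d Ω)) {k : ℤ} {P : Set (Ambient n)}
    (hP : P ∈ 𝔻 k) : IntegrableOn f P (surfaceMeasure d Ω) := by
  obtain ⟨z, -, -, hzP⟩ := h.balls k P hP
  exact (hf.integrableOn_isCompact (isCompact_closedBall z (C₁ * 2 ^ (-k)))).mono_set
    (hzP.trans (inter_subset_left.trans ball_subset_closedBall))

lemma abs_clamp_sub_le {b s t : ℝ} (ht : 0 ≤ t) : |max (b - t) (min (b + t) s) - b| ≤ t := by
  rw [abs_le]
  constructor
  · linarith [le_max_left (b - t) (min (b + t) s)]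
  · have : max (b - t) (min (b + t) s) ≤ b + t :=
      max_le (by linarith) (min_le_left _ _)
    linarith

lemma clamp_eq {b s t : ℝ} (h : |s - b| ≤ t) : max (b - t) (min (b + t) s) = s := by
  rw [abs_le] at h
  rw [min_eq_right (by linarith), max_eq_right (by linarith)]

/-- A function of bounded mean oscillation that is a sum of multiples of indicators of a packed
family of cubes is the limit of an adapted process whose change sets are packed, and whose
oscillation between neighbouring cubes is controlled by the BMO norm alone. -/
theorem exists_approximating_process {d L c₁ C₁ : ℝ} (hd : 0 < d) (hL : 1 ≤ L) (hc₁ : 0 < c₁)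
    (hC₁ : 1 ≤ C₁) (γ : ℝ) (N : ℕ) (n : ℕ) {M : ℝ} (hM : 0 < M) :
    ∃ K : ℝ, 0 < K ∧ ∀ (Ω : Set (Ambient n)) (𝔻 : ℤ → Set (Set (Ambient n))),
      IsADRBoundary d L Ω → 0 < ediam (frontier Ω) → IsDyadicSystem d Ω c₁ C₁ γ N 𝔻 →
      ∀ (Q₀ : Set (Ambient n)), (∃ k, Q₀ ∈ 𝔻 k) →
      ∀ (ι : Type*) (Q : ι → Set (Ambient n)), (∀ j, (∃ k, Q j ∈ 𝔻 k) ∧ Q j ⊆ Q₀) →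
      ∀ (α : ι → ℝ) (f : Ambient n → ℝ),
        (∀ᵐ x ∂(surfaceMeasure d Ω), HasSum (fun j => (Q j).indicator (fun _ => α j) x) (f x)) →
        MemBMO d Ω f → 0 < bmoNorm d Ω f →
      ∀ (C₀ : ℝ), 1 ≤ C₀ →
        (∀ k, ∀ R ∈ 𝔻 k, ∑' j : {j : ι // Q j ⊆ R}, surfaceMeasure d Ω (Q j) ≤
          ENNReal.ofReal C₀ * surfaceMeasure d Ω R) →
      ∃ (a : ℤ → Ambient n → ℝ) (k₁ : ℤ) (a₀ : ℝ), IsAdapted Ω 𝔻 a ∧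
        (∀ k ≤ k₁, ∀ x ∈ frontier Ω, a k x = a₀) ∧
        (∀ k l, k - 1 ≤ l → l ≤ k + 1 → ∀ x ∈ frontier Ω, ∀ y ∈ frontier Ω,
          dist x y ≤ M * 2 ^ (-k) → |a l x - a (k - 1) y| ≤ K * bmoNorm d Ω f) ∧
        (∀ m, ∀ R ∈ 𝔻 m, ∑' p : ℕ, surfaceMeasure d Ω (R ∩ changeSet Ω a (m + p + 1)) ≤
          ENNReal.ofReal (4 * C₀) * surfaceMeasure d Ω R) ∧
        (∀ k, k₁ - 1 ≤ k → ∀ P ∈ 𝔻 k,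
          ENNReal.ofReal (L⁻¹ * (c₁ / 8) ^ d * (2 ^ (-k)) ^ d) ≤ surfaceMeasure d Ω P) ∧
        ∀ᵐ x ∂(surfaceMeasure d Ω), ∀ᶠ k in atTop, a k x = f x := by
  have hC0 : 0 < C₁ := by linarith
  obtain ⟨L', hL', hup⟩ := exists_forall_surfaceBall_le hd hL hc₁ C₁ γ N n
  obtain ⟨K₂, hK₂, hdb⟩ := exists_forall_surfaceBall_le_cube hd hL hc₁ C₁ γ N n hC0
  -- The radius `(M + 4 * C₁ + 1) * 2 ^ (-k)` swallows the neighbouring cubes of generation at least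
  -- `k - 1`; the factor 2 accounts for cubes as small as generation `k + 1`.
  obtain ⟨K₃, hK₃, hdb₃⟩ := exists_forall_surfaceBall_le_cube hd hL hc₁ C₁ γ N n
    (M := 2 * (M + 4 * C₁ + 1)) (by positivity)
  obtain ⟨K₄, hK₄, hdb₄⟩ := exists_forall_surfaceBall_le_cube hd hL hc₁ C₁ γ N n
    (M := 3 * C₁) (by positivity)
  -- Two passages from `a` to the averages cost `3 * τ = 12 * K₂ * H` each; two comparisons with the
  -- average over a common ball cost `K₃ * H` each.
  refine ⟨24 * K₂ + 2 * K₃, by positivity, ?_⟩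
  intro Ω 𝔻 hADR hdiam h Q₀ ⟨k₀, hQ₀⟩ ι Q hQ α f hf hbmo hH0 C₀ hC₀ hpack
  set σ := surfaceMeasure d Ω with hσ
  set H := bmoNorm d Ω f with hH
  have hballfin : ∀ x ∈ frontier Ω, ∀ r : ℝ, 0 < r → σ (surfaceBall Ω x r) < ⊤ :=
    fun x hx r hr => (hup Ω 𝔻 hADR hdiam h x hx r hr).trans_lt ENNReal.ofReal_lt_top
  have : IsLocallyFiniteMeasure σ := isLocallyFiniteMeasure_surfaceMeasure hballfin
  have h0 : ∀ k, ∀ P ∈ 𝔻 k, σ P ≠ 0 := fun k P hP => (h.measure_pos hL hc₁ hADR hdiam hP).ne'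
  have hT : ∀ k, ∀ P ∈ 𝔻 k, σ P ≠ ⊤ := fun k P hP => h.measure_ne_top hC₁ hballfin hP
  have hint : ∀ k, ∀ P ∈ 𝔻 k, IntegrableOn f P σ := fun k P hP => h.integrableOn hbmo.1 hP
  have hballosc : ∀ x ∈ frontier Ω, ∀ r : ℝ, 0 < r →
      ∫⁻ y in surfaceBall Ω x r, ‖f y - ⨍ z in surfaceBall Ω x r, f z ∂σ‖ₑ ∂σ ≤
        ENNReal.ofReal H * σ (surfaceBall Ω x r) := fun x hx r hr =>
    lintegral_sub_average_surfaceBall_le hbmo hx hr (hballfin x hx r hr).ne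
  set τ := 4 * (K₂ * H) with hτ
  have hτ0 : 0 < τ := by positivity
  set φ := cubeAverage d Ω 𝔻 f
  have hosc : ∀ k, ∀ x ∈ frontier Ω, ∫⁻ y in dyadicCube 𝔻 k x, ‖f y - φ k x‖ₑ ∂σ ≤
      ENNReal.ofReal (τ / 2) * σ (dyadicCube 𝔻 k x) := by
    intro k x hx
    have hP := h.dyadicCube_mem k hx
    obtain ⟨z, hz, -, hzP⟩ := h.balls k _ hP
    have hr : 0 < C₁ * (2 : ℝ) ^ (-k) := by positivity
    have := lintegral_sub_average_le (h0 k _ hP) (hT k _ hP) (hint k _ hP) hH0.le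
      (by positivity : 0 ≤ K₂) hzP (hballosc z hz _ hr) (hdb Ω 𝔻 hADR hdiam h k _ hP z hz)
    rwa [show τ / 2 = 2 * (K₂ * H) by rw [hτ]; ring]
  have hnbr : ∀ k l, k - 1 ≤ l → l ≤ k + 1 → ∀ x ∈ frontier Ω, ∀ y ∈ frontier Ω,
      dist x y ≤ M * 2 ^ (-k) → |φ l x - ⨍ w in surfaceBall Ω y
        ((M + 4 * C₁ + 1) * 2 ^ (-k)), f w ∂σ| ≤ K₃ * H := by
    intro k l hkl hlk x hx y hy hxy
    have hr : 0 < (M + 4 * C₁ + 1) * (2 : ℝ) ^ (-k) := by positivity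
    have hP := h.dyadicCube_mem l hx
    have h2l : (2 : ℝ) ^ (-l) ≤ 2 * 2 ^ (-k) := by
      rw [mul_comm, ← zpow_add_one₀ two_ne_zero]
      exact zpow_le_zpow_right₀ one_le_two (by lia)
    have h2k : (2 : ℝ) ^ (-k) ≤ 2 * 2 ^ (-l) := by
      rw [mul_comm, ← zpow_add_one₀ two_ne_zero]
      exact zpow_le_zpow_right₀ one_le_two (by lia)
    have h2k0 : (0 : ℝ) < 2 ^ (-k) := by positivity
    have hsub : dyadicCube 𝔻 l x ⊆ surfaceBall Ω y ((M + 4 * C₁ + 1) * 2 ^ (-k)) := by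
      intro w hw
      refine ⟨?_, h.dyadicCube_subset_frontier l x hw⟩
      have h1 := h.dist_le_of_mem_dyadicCube hx hw
      have h2 := dist_triangle w x y
      rw [mem_ball]
      nlinarith
    have hdbl : σ (surfaceBall Ω y ((M + 4 * C₁ + 1) * 2 ^ (-k))) ≤
        ENNReal.ofReal K₃ * σ (dyadicCube 𝔻 l x) := by
      refine (measure_mono (inter_subset_inter_left _ (ball_subset_ball ?_))).trans
        (hdb₃ Ω 𝔻 hADR hdiam h l _ hP y hy)
      have : 0 ≤ M + 4 * C₁ + 1 := by positivity
      nlinarith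
    exact abs_average_sub_le_of_subset (h0 l _ hP) (hT l _ hP) (hint l _ hP) hH0.le
      (by positivity) hsub (hballosc y hy _ hr) hdbl
  obtain ⟨k₁, b₀, s₀, hstart, hlow⟩ := h.exists_coarse_generation hd hL hc₁ hADR hdiam hQ₀
    (fun j => (hQ j).2) hT hint hf hτ0
  obtain ⟨b, hbad, hb₀, hbφ, hbstep⟩ := h.exists_stopped
    (h.isAdapted_cubeAverage (f := f)) k₁ b₀ hτ0.le fun k hk x hx => (hstart k hk x hx).1
  set s := cubeSum 𝔻 Q α
  -- The half-width `2 * τ` keeps `a` within `3 * τ` of the averages. It also makes the clamp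
  -- inactive in the limit, where `b` is within `τ` of `φ` and `φ` within `τ` of `f`.
  let a : ℤ → Ambient n → ℝ := fun k x => max (b k x - 2 * τ) (min (b k x + 2 * τ) (s k x))
  have hsad : IsAdapted Ω 𝔻 s := h.isAdapted_cubeSum
  have haφ : ∀ k, ∀ x ∈ frontier Ω, |a k x - φ k x| ≤ 3 * τ := by
    intro k x hx
    have h1 : |a k x - b k x| ≤ 2 * τ := abs_clamp_sub_le (by positivity)
    have h2 := hbφ k x hx
    rw [abs_sub_comm] at h2
    calc _ ≤ |a k x - b k x| + |b k x - φ k x| := abs_sub_le _ _ _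
      _ ≤ 3 * τ := by linarith
  refine ⟨a, k₁, max (b₀ - 2 * τ) (min (b₀ + 2 * τ) s₀), ?_, ?_, ?_, ?_, hlow, ?_⟩
  · intro k x hx y hy
    simp only [a, hbad k x hx y hy, hsad k x hx y hy]
  · intro k hk x hx
    simp only [a, hb₀ k hk x, (hstart k hk x hx).2]
  · intro k l hkl hlk x hx y hy hxy
    have h1 := abs_le.1 (haφ l x hx)
    have h2 := abs_le.1 (haφ (k - 1) y hy)
    have h3 := abs_le.1 (hnbr k l hkl hlk x hx y hy hxy)
    have h4 := abs_le.1 (hnbr k (k - 1) le_rfl (by lia) y hy y hy (by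
      rw [dist_self]; positivity))
    rw [abs_le]
    constructor <;> linarith
  · intro m R hR
    have hsub : ∀ k, changeSet Ω a k ⊆ changeSet Ω b k ∪ newCubeSet Ω 𝔻 Q k := by
      rintro k x ⟨hx, hne⟩
      by_cases hb : b k x = b (k - 1) x
      · refine Or.inr (h.changeSet_cubeSum_subset (α := α) (fun j => (hQ j).1) k ⟨hx, fun hs => ?_⟩)
        apply hne
        change s k x = s (k - 1) x at hs
        simp only [a, hb, hs]
      · exact Or.inl ⟨hx, hb⟩
    have hfin : ∑' j : {j : ι // Q j ⊆ R}, σ (Q j) ≠ ⊤ :=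
      ((hpack m R hR).trans_lt (ENNReal.mul_lt_top ENNReal.ofReal_lt_top (hT m R hR).lt_top)).ne
    calc ∑' p : ℕ, σ (R ∩ changeSet Ω a (m + p + 1))
        ≤ ∑' p : ℕ, (σ (R ∩ changeSet Ω b (m + p + 1)) +
            σ (R ∩ newCubeSet Ω 𝔻 Q (m + p + 1))) := by
          refine ENNReal.tsum_le_tsum fun p => (measure_mono ?_).trans (measure_union_le _ _)
          rw [← inter_union_distrib_left]
          exact inter_subset_inter_right _ (hsub _)
      _ ≤ 3 * σ R + ENNReal.ofReal C₀ * σ R := by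
          rw [ENNReal.tsum_add]
          exact add_le_add
            (h.tsum_measure_changeSet_stopped_le hτ0 hbad h0 hT hint hosc hbφ hbstep hR)
            ((h.tsum_measure_newCubeSet_le h0 (fun j => (hQ j).1) hR hfin).trans (hpack m R hR))
      _ ≤ ENNReal.ofReal (4 * C₀) * σ R := by
          rw [← add_mul, show (3 : ENNReal) = ENNReal.ofReal 3 by simp,
            ← ENNReal.ofReal_add (by norm_num) (by linarith)]
          gcongr
          linarith
  · have hfin : ∑' j, σ (Q j) ≠ ⊤ := by
      have h1 := (hpack k₀ Q₀ hQ₀).trans_lt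
        (ENNReal.mul_lt_top ENNReal.ofReal_lt_top (hT k₀ Q₀ hQ₀).lt_top)
      have h2 : ∑' j : {j : ι // Q j ⊆ Q₀}, σ (Q j) = ∑' j, σ (Q j) :=
        (Equiv.subtypeUnivEquiv fun j => (hQ j).2).tsum_eq fun j => σ (Q j)
      rw [← h2]
      exact h1.ne
    filter_upwards [h.ae_eventually_cubeSum_eq h0 (fun j => (hQ j).1) hfin hf,
      h.ae_tendsto_cubeAverage hC₁ h0 hT hbmo.1 (hdb₄ Ω 𝔻 hADR hdiam h),
      ae_restrict_mem isClosed_frontier.measurableSet] with x hx1 hx2 hxΩ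
    have hx3 : ∀ᶠ k in atTop, |φ k x - f x| < τ := by
      have := hx2.eventually (Metric.ball_mem_nhds (f x) hτ0)
      exact this
    filter_upwards [hx1, hx3] with k h1 h2
    change s k x = f x at h1
    simp only [a, h1]
    refine clamp_eq ?_
    have h3 := abs_le.1 (hbφ k x hxΩ)
    have h4 := abs_lt.1 h2
    rw [abs_le]
    constructor <;> linarith

end Approximation

/-! ### Neighbourhoods of jump sets, scales and projections -/

section Extension

variable {n : ℕ} {d : ℝ} {Ω : Set (Ambient n)} {c₁ C₁ γ : ℝ} {N : ℕ}
  {𝔻 : ℤ → Set (Set (Ambient n))} {β : Type*} {a : ℤ → Ambient n → β}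

namespace IsDyadicSystem

/-- Packing of the jump sets, with the constant of the packing condition of the change sets. -/
lemma tsum_measure_jumpSet_le_of_packing (h : IsDyadicSystem d Ω c₁ C₁ γ N 𝔻) (hc₁ : 0 < c₁)
    (hC₁ : 1 ≤ C₁) (hγ : 0 < γ) {M : ℝ} (hM : 0 < M) (ha : IsAdapted Ω 𝔻 a) {Λ : ℝ}
    (hΛ : 0 ≤ Λ)
    (hpack : ∀ m, ∀ R ∈ 𝔻 m, ∑' p : ℕ, surfaceMeasure d Ω (R ∩ changeSet Ω a (m + p + 1)) ≤
      ENNReal.ofReal Λ * surfaceMeasure d Ω R)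
    {m : ℤ} {D : Set (Ambient n)} (hD : IsCubeUnion Ω 𝔻 m D) :
    ∑' i : ℕ, surfaceMeasure d Ω (D ∩ jumpSet Ω 𝔻 a M m (m + i)) ≤
      ENNReal.ofReal ((1 + C₁ * M ^ γ + (M / c₁) ^ γ) * (1 - (1 / 2) ^ γ)⁻¹ * (1 + Λ)) *
        surfaceMeasure d Ω D := by
  set σ := surfaceMeasure d Ω
  have hθ1 : ((1 : ℝ) / 2) ^ γ < 1 := Real.rpow_lt_one (by norm_num) (by norm_num) hγ
  have hθ0 : (0 : ℝ) ≤ (1 / 2) ^ γ := by positivity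
  have h1 : ∑' p : ℕ, σ (D ∩ changeSet Ω a (m + p + 1)) ≤ ENNReal.ofReal Λ * σ D := by
    have hc : {R ∈ 𝔻 m | R ⊆ D}.Countable := (h.countable m).mono fun R hR => hR.1
    calc ∑' p : ℕ, σ (D ∩ changeSet Ω a (m + p + 1))
        ≤ ∑' (p : ℕ) (R : {R ∈ 𝔻 m | R ⊆ D}), σ (R ∩ changeSet Ω a (m + p + 1)) := by
          refine ENNReal.tsum_le_tsum fun p => ?_
          conv_lhs => rw [hD.eq_biUnion h, iUnion₂_inter]
          exact measure_biUnion_le σ hc _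
      _ = ∑' (R : {R ∈ 𝔻 m | R ⊆ D}) (p : ℕ), σ (R ∩ changeSet Ω a (m + p + 1)) :=
          ENNReal.tsum_comm
      _ ≤ ∑' R : {R ∈ 𝔻 m | R ⊆ D}, ENNReal.ofReal Λ * σ R :=
          ENNReal.tsum_le_tsum fun R => hpack m R R.2.1
      _ = ENNReal.ofReal Λ * σ D := by
          rw [ENNReal.tsum_mul_left, ← hD.measure_eq_tsum h σ]
  refine (h.tsum_measure_jumpSet_le hc₁ hC₁ hγ hM ha hD).trans ?_
  have h2 : 1 - ENNReal.ofReal ((1 / 2) ^ γ) = ENNReal.ofReal (1 - (1 / 2) ^ γ) := by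
    rw [ENNReal.ofReal_sub _ hθ0, ENNReal.ofReal_one]
  have h3 : 0 ≤ 1 + C₁ * M ^ γ + (M / c₁) ^ γ := by positivity
  have h4 : 0 ≤ (1 - ((1 : ℝ) / 2) ^ γ)⁻¹ := inv_nonneg.2 (by linarith)
  rw [h2, ← ENNReal.ofReal_inv_of_pos (by linarith), ← ENNReal.ofReal_mul h3,
    ENNReal.ofReal_mul (mul_nonneg h3 h4), mul_assoc]
  refine mul_le_mul_right ?_ _
  rw [ENNReal.ofReal_add zero_le_one hΛ, ENNReal.ofReal_one, add_mul, one_mul]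
  exact add_le_add_right h1 _

/-- The measure of a neighbourhood of a jump set is controlled by the surface measure of a
slightly larger jump set. -/
lemma measure_iUnion_ball_le (h : IsDyadicSystem d Ω c₁ C₁ γ N 𝔻) (hC₁ : 0 ≤ C₁)
    (ha : IsAdapted Ω 𝔻 a) {M : ℝ} (hM : 0 ≤ M) {m j : ℤ} (hmj : m ≤ j)
    {D : Set (Ambient n)} (hD : IsCubeUnion Ω 𝔻 m D) (μ : Measure (Ambient n)) {ρ : ℝ}
    {b : ENNReal} (hb : ∀ P ∈ 𝔻 j, ∀ z ∈ P,
      μ (ball z ((ρ + 2 * C₁) * 2 ^ (-j))) ≤ b * surfaceMeasure d Ω P) :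
    μ (⋃ w ∈ D ∩ jumpSet Ω 𝔻 a M m j, ball w (ρ * 2 ^ (-j))) ≤
      b * surfaceMeasure d Ω (D ∩ jumpSet Ω 𝔻 a (M + 2 * C₁) m j) := by
  -- Passing to whole cubes: the neighbourhood of a cube fits into one ball about any of its points,
  -- and the surface measures of the disjoint cubes add up.
  set U : Set (Ambient n) := ⋃ w ∈ D ∩ jumpSet Ω 𝔻 a M m j, dyadicCube 𝔻 j w with hUdef
  have hUsub : U ⊆ D ∩ jumpSet Ω 𝔻 a (M + 2 * C₁) m j := by
    refine iUnion₂_subset fun w hw => subset_inter ?_ (h.dyadicCube_subset_jumpSet hC₁ ha hM hw.2)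
    exact (hD.mono h hmj).2 w hw.1
  have hU : IsCubeUnion Ω 𝔻 j U := by
    refine ⟨fun y hy => hD.1 (hUsub hy).1, fun y hy => ?_⟩
    obtain ⟨w, hw, hyw⟩ := mem_iUnion₂.1 hy
    rw [h.dyadicCube_congr le_rfl hw.2.1 hyw]
    exact subset_biUnion_of_mem (u := fun w => dyadicCube 𝔻 j w) hw
  have hc : {P ∈ 𝔻 j | P ⊆ U}.Countable := (h.countable j).mono fun P hP => hP.1
  have hcover : (⋃ w ∈ D ∩ jumpSet Ω 𝔻 a M m j, ball w (ρ * 2 ^ (-j))) ⊆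
      ⋃ P ∈ {P ∈ 𝔻 j | P ⊆ U}, ⋃ w ∈ P, ball w (ρ * 2 ^ (-j)) := by
    refine iUnion₂_subset fun w hw => ?_
    have hwP := h.mem_dyadicCube j hw.2.1
    refine subset_trans ?_ (subset_biUnion_of_mem (u := fun P => ⋃ w ∈ P, ball w (ρ * 2 ^ (-j)))
      (x := dyadicCube 𝔻 j w) ⟨h.dyadicCube_mem j hw.2.1, ?_⟩)
    · exact subset_biUnion_of_mem (u := fun w => ball w (ρ * 2 ^ (-j))) hwP
    · exact subset_biUnion_of_mem (u := fun w => dyadicCube 𝔻 j w) hw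
  refine (measure_mono hcover).trans ((measure_biUnion_le μ hc _).trans ?_)
  refine le_trans ?_ (mul_le_mul_right (measure_mono hUsub) b)
  rw [hU.measure_eq_tsum h, ← ENNReal.tsum_mul_left]
  refine ENNReal.tsum_le_tsum ?_
  rintro ⟨P, hP, -⟩
  rcases P.eq_empty_or_nonempty with rfl | ⟨z, hz⟩
  · simp
  refine (measure_mono (iUnion₂_subset fun w hw => ball_subset_ball' ?_)).trans (hb P hP z hz)
  have hzΩ := h.subset_frontier hP hz
  have hw' : w ∈ dyadicCube 𝔻 j z := by
    rw [h.dyadicCube_eq hP hz]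
    exact hw
  have := h.dist_le_of_mem_dyadicCube hzΩ hw'
  rw [add_mul]
  linarith

/-- The union of the cubes of generation `m` that meet a ball. -/
lemma isCubeUnion_meeting (h : IsDyadicSystem d Ω c₁ C₁ γ N 𝔻) (m : ℤ) (x : Ambient n) (r : ℝ) :
    IsCubeUnion Ω 𝔻 m {y ∈ frontier Ω | ∃ w ∈ dyadicCube 𝔻 m y, dist w x < r} := by
  refine ⟨fun y hy => hy.1, fun y hy z hz => ⟨h.dyadicCube_subset_frontier m y hz, ?_⟩⟩
  rw [h.dyadicCube_congr le_rfl hy.1 hz]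
  exact hy.2

end IsDyadicSystem

/-- A scale and a nearest boundary point for each point of `Ω`. -/
lemma exists_scale_and_projection (hΩ : IsOpen Ω) (hne : (frontier Ω).Nonempty) :
    ∃ (k : Ambient n → ℤ) (p : Ambient n → Ambient n), (∀ X ∈ Ω, 0 < bdryDist Ω X) ∧
      (∀ X ∈ Ω, 2 ^ (-k X) ≤ bdryDist Ω X ∧ bdryDist Ω X < 2 * 2 ^ (-k X)) ∧
      (∀ X, p X ∈ frontier Ω ∧ dist X (p X) = bdryDist Ω X) ∧
      ∀ X ∈ Ω, ∀ Y ∈ Ω, dist Y X ≤ bdryDist Ω X / 10 →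
        k X - 1 ≤ k Y ∧ k Y ≤ k X + 1 ∧ dist X (p Y) ≤ 12 / 5 * 2 ^ (-k X) := by
  have hpos : ∀ X ∈ Ω, 0 < bdryDist Ω X := by
    intro X hX
    refine (isClosed_frontier.notMem_iff_infDist_pos hne).1 fun hc => ?_
    rw [hΩ.frontier_eq] at hc
    exact hc.2 hX
  have hk : ∀ X, ∃ k : ℤ, X ∈ Ω → 2 ^ (-k) ≤ bdryDist Ω X ∧ bdryDist Ω X < 2 * 2 ^ (-k) := by
    intro X
    by_cases hX : X ∈ Ω
    · obtain ⟨j, hj1, hj2⟩ := exists_mem_Ico_zpow (hpos X hX) one_lt_two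
      refine ⟨-j, fun _ => ?_⟩
      rw [neg_neg, mul_comm, ← zpow_add_one₀ two_ne_zero]
      exact ⟨hj1, hj2⟩
    · exact ⟨0, fun hc => absurd hc hX⟩
  have hp : ∀ X, ∃ p ∈ frontier Ω, dist X p = bdryDist Ω X := fun X => by
    obtain ⟨p, hp, hd⟩ := isClosed_frontier.exists_infDist_eq_dist hne X
    exact ⟨p, hp, hd.symm⟩
  choose k hk using hk
  choose p hpΩ hpd using hp
  refine ⟨k, p, hpos, fun X hX => hk X hX, fun X => ⟨hpΩ X, hpd X⟩, ?_⟩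
  intro X hX Y hY hYX
  obtain ⟨hX1, hX2⟩ := hk X hX
  obtain ⟨hY1, hY2⟩ := hk Y hY
  have hlip : |bdryDist Ω Y - bdryDist Ω X| ≤ dist Y X := by
    have := (lipschitz_infDist_pt (frontier Ω)).dist_le_mul Y X
    rwa [Real.dist_eq, NNReal.coe_one, one_mul] at this
  have hlip' := abs_le.1 (hlip.trans hYX)
  have hX0 : (0 : ℝ) < 2 ^ (-k X) := by positivity
  refine ⟨?_, ?_, ?_⟩
  · have : (2 : ℝ) ^ (-k Y) < 2 ^ (-k X + 1 + 1) := by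
      rw [zpow_add_one₀ two_ne_zero, zpow_add_one₀ two_ne_zero]
      linarith
    have := (zpow_lt_zpow_iff_right₀ (one_lt_two (α := ℝ))).1 this
    lia
  · have : (2 : ℝ) ^ (-k X) < 2 ^ (-k Y + 1 + 1) := by
      rw [zpow_add_one₀ two_ne_zero, zpow_add_one₀ two_ne_zero]
      linarith
    have := (zpow_lt_zpow_iff_right₀ (one_lt_two (α := ℝ))).1 this
    lia
  -- The distance is at most `(1 / 10 + 11 / 10) * bdryDist Ω X`, and the scale satisfies `bdryDist
  -- Ω X < 2 * 2 ^ (-k X)`.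
  · have h1 := dist_triangle X Y (p Y)
    rw [hpd Y, dist_comm X Y] at h1
    linarith

end Extension

/-! ### Nontangential convergence and the Carleson estimate -/

section Main

variable {n : ℕ} {d : ℝ} {Ω : Set (Ambient n)} {c₁ C₁ γ : ℝ} {N : ℕ}
  {𝔻 : ℤ → Set (Set (Ambient n))} {a : ℤ → Ambient n → ℝ}

lemma surfaceMeasure_ball (z : Ambient n) (r : ℝ) :
    surfaceMeasure d Ω (ball z r) = surfaceMeasure d Ω (surfaceBall Ω z r) := by
  rw [surfaceBall, surfaceMeasure, Measure.restrict_apply measurableSet_ball,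
    Measure.restrict_apply (measurableSet_ball.inter isClosed_frontier.measurableSet),
    inter_assoc, inter_self]

/-- Almost every boundary point is, eventually, far from the jump sets, at scale `2 ^ (-j)`. -/
lemma IsDyadicSystem.ae_eventually_le_dist_jumpSet (h : IsDyadicSystem d Ω c₁ C₁ γ N 𝔻)
    (hC₁ : 0 ≤ C₁) (ha : IsAdapted Ω 𝔻 a) {M : ℝ} (hM : 0 ≤ M) {ρ : ℝ} {Kρ KM L' : ℝ}
    (hdb : ∀ k, ∀ P ∈ 𝔻 k, ∀ y ∈ frontier Ω,
      surfaceMeasure d Ω (surfaceBall Ω y ((ρ + 2 * C₁) * 2 ^ (-k))) ≤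
        ENNReal.ofReal Kρ * surfaceMeasure d Ω P)
    (hup : ∀ x ∈ frontier Ω, ∀ r : ℝ, 0 < r →
      surfaceMeasure d Ω (surfaceBall Ω x r) ≤ ENNReal.ofReal (L' * r ^ d))
    (hjump : ∀ m, ∀ D, IsCubeUnion Ω 𝔻 m D →
      ∑' i : ℕ, surfaceMeasure d Ω (D ∩ jumpSet Ω 𝔻 a (M + 2 * C₁) m (m + i)) ≤
        ENNReal.ofReal KM * surfaceMeasure d Ω D)
    {x₀ : Ambient n} (hx₀ : x₀ ∈ frontier Ω) :
    ∀ᵐ x ∂(surfaceMeasure d Ω), ∀ R : ℕ, ∀ᶠ i : ℕ in atTop,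
      ∀ w ∈ {y ∈ frontier Ω | ∃ w ∈ dyadicCube 𝔻 0 y, dist w x₀ < R} ∩
        jumpSet Ω 𝔻 a M 0 i, ρ * 2 ^ (-(i : ℤ)) ≤ dist x w := by
  rw [ae_all_iff]
  intro R
  set σ := surfaceMeasure d Ω
  set D : Set (Ambient n) := {y ∈ frontier Ω | ∃ w ∈ dyadicCube 𝔻 0 y, dist w x₀ < R}
  have hD : IsCubeUnion Ω 𝔻 0 D := h.isCubeUnion_meeting 0 x₀ R
  have hDT : σ D ≠ ⊤ := by
    have hsub : D ⊆ surfaceBall Ω x₀ (R + 2 * C₁ + 1) := by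
      rintro y ⟨hy, w, hw, hwx⟩
      refine ⟨?_, hy⟩
      have h1 := h.dist_le_of_mem_dyadicCube hy hw
      have h2 := dist_triangle_left y x₀ w
      rw [neg_zero, zpow_zero, mul_one] at h1
      rw [mem_ball]
      linarith
    exact ((measure_mono hsub).trans_lt
      ((hup x₀ hx₀ _ (by positivity)).trans_lt ENNReal.ofReal_lt_top)).ne
  -- Borel–Cantelli for the neighbourhoods of the jump sets; doubling and packing make their
  -- measures summable. The restriction to `D` is there to make the total finite.
  let T : ℕ → Set (Ambient n) := fun i =>
    ⋃ w ∈ D ∩ jumpSet Ω 𝔻 a M 0 i, ball w (ρ * 2 ^ (-(i : ℤ)))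
  have hT : ∑' i, σ (T i) ≠ ⊤ := by
    refine ne_top_of_le_ne_top (ENNReal.mul_ne_top (ENNReal.ofReal_ne_top (r := Kρ))
      (ENNReal.mul_ne_top (ENNReal.ofReal_ne_top (r := KM)) hDT)) ?_
    calc ∑' i, σ (T i)
        ≤ ∑' i : ℕ, ENNReal.ofReal Kρ * σ (D ∩ jumpSet Ω 𝔻 a (M + 2 * C₁) 0 i) := by
          refine ENNReal.tsum_le_tsum fun i => ?_
          refine h.measure_iUnion_ball_le hC₁ ha hM (by lia) hD σ fun P hP z hz => ?_
          rw [surfaceMeasure_ball]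
          exact hdb _ P hP z (h.subset_frontier hP hz)
      _ ≤ _ := by
          rw [ENNReal.tsum_mul_left]
          have := hjump 0 D hD
          simp only [zero_add] at this
          exact mul_le_mul_right this _
  filter_upwards [ae_eventually_notMem hT] with x hx
  filter_upwards [hx] with i hi w hw
  by_contra! hcon
  exact hi (mem_iUnion₂.2 ⟨w, hw, hcon⟩)

variable {k : Ambient n → ℤ} {p : Ambient n → Ambient n} {F : Ambient n → ℝ} {Cs : ℝ}

/-- Nontangential convergence of the smoothed extension. -/
lemma IsDyadicSystem.tendsto_ntCone (h : IsDyadicSystem d Ω c₁ C₁ γ N 𝔻)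
    (ha : IsAdapted Ω 𝔻 a) {m M : ℝ} (hm : 0 ≤ m) (hM : M = 5 + 2 * m)
    (hk : ∀ X ∈ Ω, 2 ^ (-k X) ≤ bdryDist Ω X ∧ bdryDist Ω X < 2 * 2 ^ (-k X))
    (hp : ∀ X, p X ∈ frontier Ω ∧ dist X (p X) = bdryDist Ω X)
    (hkp : ∀ X ∈ Ω, ∀ Y ∈ Ω, dist Y X ≤ bdryDist Ω X / 10 →
      k X - 1 ≤ k Y ∧ k Y ≤ k X + 1 ∧ dist X (p Y) ≤ 12 / 5 * 2 ^ (-k X))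
    (hF : ∀ X ∈ Ω, ∀ B g : ℝ,
      (∀ Y ∈ Ω, dist Y X ≤ bdryDist Ω X / 10 → |a (k Y) (p Y) - g| ≤ B) →
        |F X - g| ≤ B ∧ ‖gradient F X‖ ≤ Cs * B / bdryDist Ω X)
    {x₀ x : Ambient n} (hx : x ∈ frontier Ω)
    (hev : ∀ R : ℕ, ∀ᶠ i : ℕ in atTop,
      ∀ w ∈ {y ∈ frontier Ω | ∃ w ∈ dyadicCube 𝔻 0 y, dist w x₀ < R} ∩
        jumpSet Ω 𝔻 a M 0 i, (2 * M + 1) * 2 ^ (-(i : ℤ)) ≤ dist x w)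
    {t : ℝ} (hlim : ∀ᶠ j in atTop, a j x = t) :
    Tendsto F (𝓝[ntCone Ω m x] x) (𝓝 t) := by
  have hM0 : 0 < M := by rw [hM]; positivity
  obtain ⟨R, hR⟩ := exists_nat_gt (dist x x₀ + M)
  obtain ⟨I, hI⟩ := eventually_atTop.1 (hev R)
  obtain ⟨J, hJ⟩ := eventually_atTop.1 hlim
  set K₀ : ℤ := max J I + 1 with hK₀
  have hball : ball x (2 ^ (-K₀)) ∈ 𝓝 x := ball_mem_nhds x (by positivity)
  refine tendsto_const_nhds.congr' ?_
  filter_upwards [inter_mem_nhdsWithin (ntCone Ω m x) hball] with X hX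
  obtain ⟨⟨hXΩ, hXm⟩, hXb⟩ := hX
  obtain ⟨hX1, hX2⟩ := hk X hXΩ
  have hXx : bdryDist Ω X ≤ dist X x := infDist_le_dist_of_mem hx
  have hkX : K₀ < k X := by
    have h1 : (2 : ℝ) ^ (-k X) < 2 ^ (-K₀) := (hX1.trans hXx).trans_lt hXb
    have := (zpow_lt_zpow_iff_right₀ (one_lt_two (α := ℝ))).1 h1
    lia
  have hpow : (0 : ℝ) < 2 ^ (-k X) := by positivity
  -- The limit is attained: near `x` in the cone the unsmoothed extension is locally constant with
  -- value `t`, so the smoothing estimate applies with `B = 0`.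
  suffices hsuff : |F X - t| ≤ 0 by
    have := abs_nonpos_iff.1 hsuff
    linarith
  refine (hF X hXΩ 0 t fun Y hY hYX => ?_).1
  obtain ⟨hY1, hY2, hY3⟩ := hkp X hXΩ Y hY hYX
  suffices heq : a (k Y) (p Y) = a (k X - 1) x by
    rw [heq, hJ _ (by lia), sub_self, abs_zero]
  by_contra hne
  have hdist : dist (p Y) x ≤ M * 2 ^ (-k X) := by
    have h1 := dist_triangle_left (p Y) x X
    have h2 : dist X x ≤ m * (2 * 2 ^ (-k X)) :=
      hXm.le.trans (mul_le_mul_of_nonneg_left hX2.le hm)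
    rw [hM]
    nlinarith
  obtain ⟨j, hj1, hj2, hj⟩ := ha.exists_mem_jumpSet (m := 0) (by lia) hY1 hY2 (hp Y).1 hx
    hdist hM0.le hne
  obtain ⟨w, hwx, hwj⟩ : ∃ w, dist w x ≤ M * 2 ^ (-k X) ∧ w ∈ jumpSet Ω 𝔻 a M 0 j := by
    rcases hj with hj | hj
    · exact ⟨_, hdist, hj⟩
    · exact ⟨x, by rw [dist_self]; positivity, hj⟩
  obtain ⟨i, rfl⟩ : ∃ i : ℕ, j = i := ⟨j.toNat, by lia⟩
  have hkle : (2 : ℝ) ^ (-k X) ≤ 1 := by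
    rw [← zpow_zero (2 : ℝ)]
    exact zpow_le_zpow_right₀ one_le_two (by lia)
  have hwD : w ∈ {y ∈ frontier Ω | ∃ w ∈ dyadicCube 𝔻 0 y, dist w x₀ < R} := by
    refine ⟨hwj.1, w, h.mem_dyadicCube 0 hwj.1, ?_⟩
    have h1 := dist_triangle w x x₀
    nlinarith
  -- Contradiction: `w` is within `M * 2 ^ (-k X) ≤ 2 * M * 2 ^ (-i)` of `x`, less than the
  -- guaranteed `(2 * M + 1) * 2 ^ (-i)`.
  have hfar := hI i (by lia) w ⟨hwD, hwj⟩
  have hi2 : (2 : ℝ) ^ (-k X) ≤ 2 * 2 ^ (-(i : ℤ)) := by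
    rw [mul_comm, ← zpow_add_one₀ two_ne_zero]
    exact zpow_le_zpow_right₀ one_le_two (by lia)
  have hi0 : (0 : ℝ) < 2 ^ (-(i : ℤ)) := by positivity
  rw [dist_comm] at hwx
  nlinarith

/-- The Carleson measure estimate for the gradient of the smoothed extension. -/
lemma IsDyadicSystem.lintegral_gradient_le (h : IsDyadicSystem d Ω c₁ C₁ γ N 𝔻)
    (hdn : d ≤ n) (hC₁ : 0 < C₁) (ha : IsAdapted Ω 𝔻 a) {M : ℝ} (hM : 5 ≤ M)
    {κ KM L' B a₀ : ℝ} (hκ : 0 < κ) (hKM : 0 ≤ KM) (hB : 0 ≤ B) (hCs : 0 ≤ Cs)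
    {k₁ : ℤ} (hconst : ∀ j ≤ k₁, ∀ x ∈ frontier Ω, a j x = a₀)
    (hnbr : ∀ j l, j - 1 ≤ l → l ≤ j + 1 → ∀ x ∈ frontier Ω, ∀ y ∈ frontier Ω,
      dist x y ≤ M * 2 ^ (-j) → |a l x - a (j - 1) y| ≤ B)
    (hlow : ∀ j, k₁ - 1 ≤ j → ∀ P ∈ 𝔻 j,
      ENNReal.ofReal (κ * (2 ^ (-j)) ^ d) ≤ surfaceMeasure d Ω P)
    (hup : ∀ x ∈ frontier Ω, ∀ r : ℝ, 0 < r →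
      surfaceMeasure d Ω (surfaceBall Ω x r) ≤ ENNReal.ofReal (L' * r ^ d))
    (hjump : ∀ m, ∀ D, IsCubeUnion Ω 𝔻 m D →
      ∑' i : ℕ, surfaceMeasure d Ω (D ∩ jumpSet Ω 𝔻 a (M + 2 * C₁) m (m + i)) ≤
        ENNReal.ofReal KM * surfaceMeasure d Ω D)
    (hk : ∀ X ∈ Ω, 2 ^ (-k X) ≤ bdryDist Ω X ∧ bdryDist Ω X < 2 * 2 ^ (-k X))
    (hp : ∀ X, p X ∈ frontier Ω ∧ dist X (p X) = bdryDist Ω X)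
    (hkp : ∀ X ∈ Ω, ∀ Y ∈ Ω, dist Y X ≤ bdryDist Ω X / 10 →
      k X - 1 ≤ k Y ∧ k Y ≤ k X + 1 ∧ dist X (p Y) ≤ 12 / 5 * 2 ^ (-k X))
    (hF : ∀ X ∈ Ω, ∀ B g : ℝ,
      (∀ Y ∈ Ω, dist Y X ≤ bdryDist Ω X / 10 → |a (k Y) (p Y) - g| ≤ B) →
        |F X - g| ≤ B ∧ ‖gradient F X‖ ≤ Cs * B / bdryDist Ω X) :
    (∀ X ∈ Ω, ‖gradient F X‖ ≤ Cs * B / bdryDist Ω X) ∧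
    ∀ x ∈ frontier Ω, ∀ r : ℝ, 0 < r → ∫⁻ Y in ball x r ∩ Ω, ‖gradient F Y‖ₑ ≤
      ENNReal.ofReal (2 * Cs * B * ((6 + 2 * C₁) ^ (n + 1) * κ⁻¹ *
        (volume (ball (0 : Ambient n) 1)).toReal) * 4 ^ (n - d) *
        (KM * (L' * (4 + 8 * C₁) ^ d)) * r ^ n) := by
  have hpX : ∀ X ∈ Ω, dist X (p X) ≤ 2 * 2 ^ (-k X) := fun X hX => by
    rw [(hp X).2]
    exact (hk X hX).2.le
  have hpYX : ∀ X ∈ Ω, ∀ Y ∈ Ω, dist Y X ≤ bdryDist Ω X / 10 →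
      dist (p Y) (p X) ≤ M * 2 ^ (-k X) := by
    intro X hX Y hY hYX
    have h1 := dist_triangle_left (p Y) (p X) X
    have h2 := (hkp X hX Y hY hYX).2.2
    have h3 := hpX X hX
    have h4 : (0 : ℝ) < 2 ^ (-k X) := by positivity
    nlinarith
  have hgrad : ∀ X ∈ Ω, ‖gradient F X‖ ≤ Cs * B / bdryDist Ω X := by
    intro X hX
    refine (hF X hX B (a (k X - 1) (p X)) fun Y hY hYX => ?_).2
    obtain ⟨hY1, hY2, -⟩ := hkp X hX Y hY hYX
    exact hnbr _ _ hY1 hY2 _ (hp Y).1 _ (hp X).1 (hpYX X hX Y hY hYX)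
  refine ⟨hgrad, fun x hx r hr => ?_⟩
  classical
  set σ := surfaceMeasure d Ω
  set v := (volume (ball (0 : Ambient n) 1)).toReal with hv
  obtain ⟨g, hg1, hg2⟩ : ∃ g : ℤ, 2 * r < 2 ^ (-g) ∧ (2 : ℝ) ^ (-g) ≤ 4 * r := by
    obtain ⟨j, hj1, hj2⟩ := exists_mem_Ico_zpow (by positivity : 0 < 4 * r) one_lt_two
    refine ⟨-j, ?_, by rwa [neg_neg]⟩
    rw [zpow_add_one₀ two_ne_zero] at hj2
    rw [neg_neg]
    linarith
  -- The radius `4 * r` suffices: a jump point `w` attached to `X` in the ball lies within `12 / 5 *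
  -- r + r` of `x`.
  set D : Set (Ambient n) := {y ∈ frontier Ω | ∃ w ∈ dyadicCube 𝔻 g y, dist w x < 4 * r}
  have hD : IsCubeUnion Ω 𝔻 g D := h.isCubeUnion_meeting g x (4 * r)
  have hDσ : σ D ≤ ENNReal.ofReal (L' * (4 + 8 * C₁) ^ d * r ^ d) := by
    have hsub : D ⊆ surfaceBall Ω x ((4 + 8 * C₁) * r) := by
      rintro y ⟨hy, w, hw, hwx⟩
      refine ⟨?_, hy⟩
      have h1 := h.dist_le_of_mem_dyadicCube hy hw
      have h2 := dist_triangle_left y x w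
      rw [mem_ball]
      nlinarith
    refine (measure_mono hsub).trans ((hup x hx _ (by positivity)).trans (le_of_eq ?_))
    rw [Real.mul_rpow (by positivity) hr.le, mul_assoc]
  -- Coarser generations are dropped: there `a` is constant, so no gradient arises, and the lower
  -- bound for cubes is not available. The radius 6 exceeds `2 * 12 / 5`, as the jump may occur one
  -- generation after `k X`.
  let T : ℕ → Set (Ambient n) := fun i =>
    if k₁ - 1 ≤ g + i then
      ⋃ w ∈ D ∩ jumpSet Ω 𝔻 a M g (g + i), ball w (6 * 2 ^ (-(g + i : ℤ)))
    else ∅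
  have hTm : ∀ i, MeasurableSet (T i) := by
    intro i
    simp only [T]
    split_ifs
    · exact (isOpen_biUnion fun w _ => isOpen_ball).measurableSet
    · exact MeasurableSet.empty
  let u : ℕ → ENNReal := fun i => ENNReal.ofReal (2 * Cs * B * 2 ^ (g + i : ℤ))
  have hpt : ∀ X ∈ ball x r ∩ Ω, ‖gradient F X‖ₑ ≤ ∑' i, (T i).indicator (fun _ => u i) X := by
    rintro X ⟨hXb, hX⟩
    obtain ⟨hX1, hX2⟩ := hk X hX
    have hXr : bdryDist Ω X < r := (infDist_le_dist_of_mem hx).trans_lt hXb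
    by_cases hbad : ∀ Y ∈ Ω, dist Y X ≤ bdryDist Ω X / 10 →
        a (k Y) (p Y) = a (k X - 1) (p X)
    · have h0 : ‖gradient F X‖ ≤ 0 := by
        refine ((hF X hX 0 (a (k X - 1) (p X)) fun Y hY hYX => ?_).2).trans (by simp)
        rw [hbad Y hY hYX, sub_self, abs_zero]
      rw [norm_le_zero_iff.1 h0, enorm_zero]
      exact zero_le
    · push Not at hbad
      obtain ⟨Y, hY, hYX, hne⟩ := hbad
      obtain ⟨hY1, hY2, hY3⟩ := hkp X hX Y hY hYX
      have hgk : g < k X := by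
        have h1 : (2 : ℝ) ^ (-k X) < 2 ^ (-g) := by linarith
        have := (zpow_lt_zpow_iff_right₀ (one_lt_two (α := ℝ))).1 h1
        lia
      have hk₁X : k₁ < k X + 1 := by
        by_contra! hcon
        exact hne ((hconst _ (by lia) _ (hp Y).1).trans (hconst _ (by lia) _ (hp X).1).symm)
      obtain ⟨j, hj1, hj2, hj⟩ := ha.exists_mem_jumpSet hgk hY1 hY2 (hp Y).1 (hp X).1
        (hpYX X hX Y hY hYX) (by linarith) hne
      have hX0 : (0 : ℝ) < 2 ^ (-k X) := by positivity
      obtain ⟨w, hwX, hwj⟩ : ∃ w, dist X w ≤ 12 / 5 * 2 ^ (-k X) ∧ w ∈ jumpSet Ω 𝔻 a M g j := by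
        rcases hj with hj | hj
        · exact ⟨_, hY3, hj⟩
        · exact ⟨_, by linarith [hpX X hX], hj⟩
      obtain ⟨i, rfl⟩ : ∃ i : ℕ, j = g + i := ⟨(j - g).toNat, by lia⟩
      have hpj : (2 : ℝ) ^ (-k X) ≤ 2 * 2 ^ (-(g + i : ℤ)) := by
        rw [mul_comm, ← zpow_add_one₀ two_ne_zero]
        exact zpow_le_zpow_right₀ one_le_two (by lia)
      have hwD : w ∈ D := by
        refine ⟨hwj.1, w, h.mem_dyadicCube g hwj.1, ?_⟩
        have h1 := dist_triangle_left w x X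
        have h2 : dist X x < r := hXb
        linarith
      have hXT : X ∈ T i := by
        simp only [T]
        rw [if_pos (by lia)]
        refine mem_iUnion₂.2 ⟨w, ⟨hwD, hwj⟩, ?_⟩
        have : (0 : ℝ) < 2 ^ (-(g + i : ℤ)) := by positivity
        rw [mem_ball]
        linarith
      refine le_trans ?_ (ENNReal.le_tsum i)
      rw [indicator_of_mem hXT, ← ofReal_norm]
      refine ENNReal.ofReal_le_ofReal ((hgrad X hX).trans ?_)
      have hinv : (2 : ℝ) ^ (k X) ≤ 2 * 2 ^ (g + i : ℤ) := by
        rw [mul_comm, ← zpow_add_one₀ two_ne_zero]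
        exact zpow_le_zpow_right₀ one_le_two (by lia)
      calc Cs * B / bdryDist Ω X ≤ Cs * B / 2 ^ (-k X) := by gcongr
        _ = Cs * B * 2 ^ (k X) := by rw [zpow_neg, div_inv_eq_mul]
        _ ≤ Cs * B * (2 * 2 ^ (g + i : ℤ)) := by gcongr
        _ = _ := by ring
  have hvT : volume (ball (0 : Ambient n) 1) = ENNReal.ofReal v :=
    (ENNReal.ofReal_toReal measure_ball_lt_top.ne).symm
  have hv0 : 0 ≤ v := ENNReal.toReal_nonneg
  set V : ℝ := (6 + 2 * C₁) ^ (n + 1) * κ⁻¹ * v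
  have hV0 : 0 ≤ V := by positivity
  -- With `s` the side length, the gradient is of order `s⁻¹` and the volume of order `s ^ (n + 1 -
  -- d)` times surface measure. The product `s ^ (n - d)` is at most `(4 * r) ^ (n - d)`, because `d
  -- ≤ n`.
  have hT : ∀ i, u i * volume (T i) ≤ ENNReal.ofReal (2 * Cs * B * V * (4 * r) ^ (n - d)) *
      σ (D ∩ jumpSet Ω 𝔻 a (M + 2 * C₁) g (g + i)) := by
    intro i
    by_cases hi : k₁ - 1 ≤ g + i
    swap
    · simp only [T, if_neg hi, measure_empty, mul_zero, zero_le]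
    simp only [T, if_pos hi, u]
    set s : ℝ := 2 ^ (-(g + i : ℤ)) with hs
    have hs0 : 0 < s := by positivity
    have hvol := h.measure_iUnion_ball_le hC₁.le ha (by linarith : 0 ≤ M)
      (by lia : g ≤ g + i) hD volume (ρ := 6)
      (b := ENNReal.ofReal (V * s ^ (n + 1 - d))) (by
        intro P hP z hz
        rw [Measure.addHaar_ball volume z (by positivity), hvT, finrank_euclideanSpace_fin]
        refine le_trans (le_of_eq ?_) (mul_le_mul_right (hlow _ hi P hP) _)
        rw [← ENNReal.ofReal_mul (by positivity), ← ENNReal.ofReal_mul (by positivity)]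
        congr 1
        rw [← hs, mul_pow, ← Real.rpow_natCast s (n + 1), Real.rpow_sub hs0]
        have hsd : 0 < s ^ d := by positivity
        simp only [V]
        push_cast
        field_simp)
    refine (mul_le_mul_right hvol _).trans ?_
    rw [← mul_assoc, ← ENNReal.ofReal_mul (by positivity)]
    refine mul_le_mul_left (ENNReal.ofReal_le_ofReal ?_) _
    have h2 : (2 : ℝ) ^ (g + i : ℤ) = s⁻¹ := by rw [hs, zpow_neg, inv_inv]
    have h3 : s⁻¹ * s ^ (n + 1 - d) = s ^ (n - d) := by
      rw [show (n : ℝ) + 1 - d = n - d + 1 by ring, Real.rpow_add_one hs0.ne']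
      field_simp
    have h4 : s ≤ 4 * r := by
      refine le_trans ?_ hg2
      exact zpow_le_zpow_right₀ one_le_two (by lia)
    calc 2 * Cs * B * 2 ^ (g + i : ℤ) * (V * s ^ (n + 1 - d))
        = 2 * Cs * B * V * (s⁻¹ * s ^ (n + 1 - d)) := by rw [h2]; ring
      _ = 2 * Cs * B * V * s ^ (n - d) := by rw [h3]
      _ ≤ _ := by
          refine mul_le_mul_of_nonneg_left ?_ (by positivity)
          exact Real.rpow_le_rpow hs0.le h4 (by linarith)
  calc ∫⁻ Y in ball x r ∩ Ω, ‖gradient F Y‖ₑ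
      ≤ ∫⁻ Y, ∑' i, (T i).indicator (fun _ => u i) Y := by
        refine (setLIntegral_mono (Measurable.tsum fun i =>
          measurable_const.indicator (hTm i)) hpt).trans (setLIntegral_le_lintegral _ _)
    _ = ∑' i, u i * volume (T i) := by
        rw [lintegral_tsum fun i => (measurable_const.indicator (hTm i)).aemeasurable]
        exact tsum_congr fun i => lintegral_indicator_const (hTm i) _
    _ ≤ ENNReal.ofReal (2 * Cs * B * V * (4 * r) ^ (n - d)) *
        (ENNReal.ofReal KM * ENNReal.ofReal (L' * (4 + 8 * C₁) ^ d * r ^ d)) := by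
        refine (ENNReal.tsum_le_tsum hT).trans ?_
        rw [ENNReal.tsum_mul_left]
        gcongr
        exact (hjump g D hD).trans (mul_le_mul_right hDσ _)
    _ = _ := by
        rw [← ENNReal.ofReal_mul hKM, ← ENNReal.ofReal_mul (by positivity)]
        congr 1
        rw [Real.mul_rpow (by norm_num) hr.le, Real.rpow_sub hr, Real.rpow_natCast]
        have hrd : 0 < r ^ d := by positivity
        field_simp

end Main

/-! ### Degenerate cases and assembly -/

/-- For `d > 0` points are null, so on a boundary with at most one point all oscillations vanish. A
positive diameter is needed because otherwise ADR says nothing. -/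
lemma ediam_frontier_pos_of_bmoNorm_pos {n : ℕ} {d : ℝ} (hd : 0 < d) {Ω : Set (Ambient n)}
    {f : Ambient n → ℝ} (hH : 0 < bmoNorm d Ω f) : 0 < ediam (frontier Ω) := by
  by_contra hcon
  have h0 : ediam (frontier Ω) = 0 := nonpos_iff_eq_zero.1 (not_lt.1 hcon)
  have hsub : (frontier Ω).Subsingleton := ediam_eq_zero_iff.1 h0
  have hσ : surfaceMeasure d Ω = 0 := by
    have : NullSingletonClass (μH[d] : Measure (Ambient n)) :=
      Measure.nullSingletonClass_hausdorff _ hd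
    exact Measure.restrict_eq_zero.2 (hsub.measure_zero _)
  have : bmoNorm d Ω f = 0 := by
    simp [bmoNorm, bmoENorm, hσ]
  exact hH.ne' this

theorem proposition1p3
    (n : ℕ) (d : ℝ) (hd : 0 < d) (hdn : d ≤ n)
    -- the ADR and corkscrew constants
    (L : ℝ) (hL : 1 ≤ L) (c : ℝ) (hc : 0 < c)
    -- the constants of the dyadic system
    (c₁ C₁ γ : ℝ) (hc₁ : 0 < c₁) (hC₁ : 1 ≤ C₁) (hγ : 0 < γ) (N : ℕ)
    -- the implicit constant in the bound for the coefficients, and the aperture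
    (A : ℝ) (m : ℝ) (hm : 1 < m) :
    ∃ C : ℝ, 0 < C ∧
      ∀ (Ω : Set (Ambient n)), IsOpen Ω → IsADRBoundary d L Ω → IsCorkscrew c Ω →
      ∀ (𝔻 : ℤ → Set (Set (Ambient n))), IsDyadicSystem d Ω c₁ C₁ γ N 𝔻 →
      ∀ (Q₀ : Set (Ambient n)), (∃ k, Q₀ ∈ 𝔻 k) →
      ∀ (ι : Type*) (Q : ι → Set (Ambient n)), (∀ j, (∃ k, Q j ∈ 𝔻 k) ∧ Q j ⊆ Q₀) →
      ∀ (α : ι → ℝ) (f : Ambient n → ℝ),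
        (∀ᵐ x ∂(surfaceMeasure d Ω), HasSum (fun j => (Q j).indicator (fun _ => α j) x) (f x)) →
        MemBMO d Ω f →
      ∀ (C₀ : ℝ), 1 ≤ C₀ →
        (∀ k, ∀ R ∈ 𝔻 k, ∑' j : {j : ι // Q j ⊆ R}, surfaceMeasure d Ω (Q j) ≤
          ENNReal.ofReal C₀ * surfaceMeasure d Ω R) →
        (∀ j, |α j| ≤ A * bmoNorm d Ω f) →
      ∃ F : Ambient n → ℝ,
        ContDiffOn ℝ ∞ F Ω ∧
        (∀ X ∈ Ω, ‖gradient F X‖ ≤ C * bmoNorm d Ω f / bdryDist Ω X) ∧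
        (∀ᵐ x ∂(surfaceMeasure d Ω), Tendsto F (𝓝[ntCone Ω m x] x) (𝓝 (f x))) ∧
        (∀ x ∈ frontier Ω, ∀ r : ℝ, 0 < r →
          ∫⁻ Y in ball x r ∩ Ω, ‖gradient F Y‖ₑ ≤
            ENNReal.ofReal (C * C₀ * bmoNorm d Ω f * r ^ n)) := by
  have hC0 : 0 < C₁ := by linarith
  set M : ℝ := 5 + 2 * m with hM
  have hM0 : 0 < M := by positivity
  obtain ⟨Cs, hCs, hsmooth⟩ := exists_smoothing n
  obtain ⟨K, hK, hproc⟩ := exists_approximating_process hd hL hc₁ hC₁ γ N n hM0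
  obtain ⟨L', hL', hup⟩ := exists_forall_surfaceBall_le hd hL hc₁ C₁ γ N n
  obtain ⟨Kρ, hKρ, hdb⟩ := exists_forall_surfaceBall_le_cube hd hL hc₁ C₁ γ N n
    (M := 2 * M + 1 + 2 * C₁) (by positivity)
  have hθ1 : ((1 : ℝ) / 2) ^ γ < 1 := Real.rpow_lt_one (by norm_num) (by norm_num) hγ
  have hθ2 : 0 < (1 - ((1 : ℝ) / 2) ^ γ)⁻¹ := inv_pos.2 (by linarith)
  set M' : ℝ := M + 2 * C₁ with hM'
  have hM'0 : 0 < M' := by positivity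
  set KJ : ℝ := (1 + C₁ * M' ^ γ + (M' / c₁) ^ γ) * (1 - (1 / 2) ^ γ)⁻¹ with hKJ
  have hKJ0 : 0 < KJ := by positivity
  set κ : ℝ := L⁻¹ * (c₁ / 8) ^ d with hκ
  have hκ0 : 0 < κ := by positivity
  set V : ℝ := (6 + 2 * C₁) ^ (n + 1) * κ⁻¹ * (volume (ball (0 : Ambient n) 1)).toReal with hV
  have hV0 : 0 ≤ V := mul_nonneg (by positivity) ENNReal.toReal_nonneg
  set W : ℝ := 2 * Cs * K * V * 4 ^ (n - d) * (5 * KJ * (L' * (4 + 8 * C₁) ^ d)) with hW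
  have hW0 : 0 ≤ W := by positivity
  refine ⟨Cs * K + W, by positivity, ?_⟩
  intro Ω hΩ hADR _ 𝔻 h Q₀ hQ₀ ι Q hQ α f hf hbmo C₀ hC₀ hpack hα
  set H := bmoNorm d Ω f with hH
  have hH0 : 0 ≤ H := ENNReal.toReal_nonneg
  rcases hH0.eq_or_lt with hHz | hHpos
  -- When the norm vanishes the threshold `τ` would be zero; here the coefficient bound forces `f =
  -- 0` almost everywhere, and `F = 0` works.
  · have hα0 : ∀ j, α j = 0 := fun j => by
      have := hα j
      rwa [← hHz, mul_zero, abs_nonpos_iff] at this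
    have hgrad : ∀ X, gradient (fun _ : Ambient n => (0 : ℝ)) X = 0 := fun X => by
      simp [gradient]
    refine ⟨fun _ => 0, contDiffOn_const, fun X _ => ?_, ?_, fun x _ r _ => ?_⟩
    · rw [hgrad, norm_zero, ← hHz, mul_zero, zero_div]
    · filter_upwards [hf] with x hx
      have h0 : (fun j => (Q j).indicator (fun _ => α j) x) = fun _ => 0 := by
        funext j
        simp [hα0 j]
      rw [h0] at hx
      rw [hx.unique hasSum_zero]
      exact tendsto_const_nhds
    · simp [hgrad]
  have hdiam := ediam_frontier_pos_of_bmoNorm_pos hd hHpos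
  have hne : (frontier Ω).Nonempty := by
    by_contra hcon
    rw [not_nonempty_iff_eq_empty.1 hcon, ediam_empty] at hdiam
    exact lt_irrefl _ hdiam
  obtain ⟨x₀, hx₀⟩ := hne
  obtain ⟨a, k₁, a₀, ha, hconst, hnbr, hch, hlow, hae⟩ :=
    hproc Ω 𝔻 hADR hdiam h Q₀ hQ₀ ι Q hQ α f hf hbmo hHpos C₀ hC₀ hpack
  obtain ⟨k, p, hpos, hk, hp, hkp⟩ := exists_scale_and_projection hΩ ⟨x₀, hx₀⟩
  obtain ⟨F, hFs, hF⟩ := hsmooth Ω (bdryDist Ω) hΩ (lipschitz_infDist_pt _) hpos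
    (fun Y => a (k Y) (p Y))
  have hjump : ∀ m, ∀ D, IsCubeUnion Ω 𝔻 m D →
      ∑' i : ℕ, surfaceMeasure d Ω (D ∩ jumpSet Ω 𝔻 a M' m (m + i)) ≤
        ENNReal.ofReal (KJ * (1 + 4 * C₀)) * surfaceMeasure d Ω D := fun m D hD =>
    h.tsum_measure_jumpSet_le_of_packing hc₁ hC₁ hγ hM'0 ha (by linarith) hch hD
  obtain ⟨hgrad, hcarl⟩ := h.lintegral_gradient_le hdn hC0 ha (by linarith : 5 ≤ M) hκ0
    (by positivity) (by positivity : 0 ≤ K * H) hCs.le hconst hnbr hlow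
    (hup Ω 𝔻 hADR hdiam h) hjump hk hp hkp hF
  refine ⟨F, hFs, fun X hX => (hgrad X hX).trans ?_, ?_, fun x hx r hr => (hcarl x hx r hr).trans ?_⟩
  · have := hpos X hX
    refine div_le_div_of_nonneg_right ?_ this.le
    rw [← mul_assoc]
    exact mul_le_mul_of_nonneg_right (by linarith) hH0
  · filter_upwards [h.ae_eventually_le_dist_jumpSet hC0.le ha hM0.le
      (hdb Ω 𝔻 hADR hdiam h) (hup Ω 𝔻 hADR hdiam h) hjump hx₀, hae,
      ae_restrict_mem isClosed_frontier.measurableSet] with x hx1 hx2 hxΩ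
    exact h.tendsto_ntCone ha (by linarith) hM hk hp hkp hF hxΩ hx1 hx2
  · refine ENNReal.ofReal_le_ofReal (mul_le_mul_of_nonneg_right ?_ (by positivity))
    have hX0 : 0 ≤ 2 * Cs * K * V * 4 ^ (n - d) * (KJ * (L' * (4 + 8 * C₁) ^ d)) := by positivity
    calc 2 * Cs * (K * H) * V * 4 ^ (n - d) * (KJ * (1 + 4 * C₀) * (L' * (4 + 8 * C₁) ^ d))
        = 2 * Cs * K * V * 4 ^ (n - d) * (KJ * (L' * (4 + 8 * C₁) ^ d)) * H * (1 + 4 * C₀) := by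
          ring
      _ ≤ 2 * Cs * K * V * 4 ^ (n - d) * (KJ * (L' * (4 + 8 * C₁) ^ d)) * H * (5 * C₀) := by
          refine mul_le_mul_of_nonneg_left (by linarith) (mul_nonneg hX0 hH0)
      _ = W * C₀ * H := by rw [hW]; ring
      _ ≤ (Cs * K + W) * C₀ * H := by
          refine mul_le_mul_of_nonneg_right (mul_le_mul_of_nonneg_right ?_ (by linarith)) hH0
          linarith [mul_pos hCs hK]
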